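/- Let $\pi$ be a set of primes with complement $\pi'$, and let $G$ be a finite $\pi$-separable group, i.e. one with a normal series each of whose factors is a $\pi$-group or a $\pi'$-group. For $n\ge 1$ write $n=n_\pi n_{\pi'}$ for its $\pi$- and $\pi'$-parts. Let $H^2G=Z^2(G,\mathbb C^\times)/B^2(G,\mathbb C^\times)$ (trivial action). For $c\in H^2G$, a $c$-module is a finite-dimensional complex vector space $V$ with a map $\varphi:G\to\mathrm{GL}(V)$ satisfying $\varphi(x)\varphi(y)=\alpha(x,y)\varphi(xy)$ for a cocycle $\alpha$ of class $c$, that is, a module over the twisted group algebra $\mathbb C^{c}G$. For $J\le G$, a $c|_J$-module $U$ induces the $c$-module $U^{cG}=\mathbb C^{c}G\otimes_{\mathbb C^{c}J}U$ (after choosing the section of $U$ so that its cocycle is $\alpha|_J$). Write $c=c_\pi c_{\pi'}$, where the orders of $c_\pi$ and $c_{\pi'}$ are a $\pi$-number and a $\pi'$-number. Let $V$ be an irreducible $c$-module of $G$. A $\pi$-decomposition of $V$ consists of a subgroup $J\le G$, an irreducible $c_\pi|_J$-module $V_\pi$ and an irreducible $c_{\pi'}|_J$-module $V_{\pi'}$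 of $J$ such that $V\cong(V_\pi\otimes V_{\pi'})^{cG}$, $V_\pi$ restricts irreducibly to every Hall $\pi$-subgroup of $J$, and $V_{\pi'}$ restricts irreducibly to every Hall $\pi'$-subgroup of $J$. 1. $V$ has a $\pi$-decomposition. 2. For every $\pi$-decomposition of $V$, $$(\dim V)_\pi=|G:J|_\pi\cdot\dim V_\pi,\qquad (\dim V)_{\pi'}=|G:J|_{\pi'}\cdot\dim V_{\pi'}.$$ Moreover, for every Hall $\pi$-subgroup $H$ and every Hall $\pi'$-subgroup $H'$ of $J$, the restrictions of $V_{\pi'}$ to $H$ and of $V_\pi$ to $H'$ are ordinary modules (their coclasses are trivial), and $\dim V$ is a $\pi'$-number if and only if $H$ is a Hall $\pi$-subgroup of $G$, $c_\pi=1$, $\dim V_\pi=1$, and, for $U=V_\pi\otimes V_{\pi'}$, the restrictions $U|_{H'}$ and $V_{\pi'}|_{H'}$ are equivalent as projective representations of $H'$ and $U|_{H'}$ is irreducible. 3. $\dim V$ is a $\pi'$-number if and only if there are a subgroup $J\le G$ containing a Hall $\pi$-subgroup of $G$ and a $c|_J$-module $V'$ of $J$ such that $V\cong V'^{\,cG}$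 and $V'$ restricts irreducibly to every Hall $\pi'$-subgroup of $J$. -/

import Mathlib

universe u v w w'

namespace SchurProj

/-! ### Sets of primes, Hall subgroups, separability.
A set `π` of primes is given as a set of natural numbers, of which only the prime elements matter;
`π'` is the complement `πᶜ`. -/

/-- `n` is a (positive) `π`-number: all its prime divisors lie in `π`. -/
def IsPiNumber (π : Set ℕ) (n : ℕ) : Prop :=
  n ≠ 0 ∧ ∀ p : ℕ, p.Prime → p ∣ n → p ∈ π

open Classical in
/-- The `π`-part `n_π` of a positive integer `n`. -/
noncomputable def piPart (π : Set ℕ) (n : ℕ) : ℕ :=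
  ∏ p ∈ n.primeFactors with p ∈ π, p ^ n.factorization p

/-- `H` is a Hall `π`-subgroup of `G`. -/
def IsHall {G : Type*} [Group G] (π : Set ℕ) (H : Subgroup G) : Prop :=
  IsPiNumber π (Nat.card H) ∧ IsPiNumber πᶜ H.index

/-- `G` is `π`-separable: it has a normal series `1 = N 0 ≤ N 1 ≤ ⋯ ≤ N l = G` each factor of
which is a `π`-group or a `π'`-group. -/
def IsPiSeparable (π : Set ℕ) (G : Type*) [Group G] : Prop :=
  ∃ (l : ℕ) (N : ℕ → Subgroup G), N 0 = ⊥ ∧ N l = ⊤ ∧ (∀ i, (N i).Normal) ∧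
    ∀ i < l, N i ≤ N (i + 1) ∧
      (IsPiNumber π ((N i).relIndex (N (i + 1))) ∨ IsPiNumber πᶜ ((N i).relIndex (N (i + 1))))

/-! ### Cocycles, coboundaries and the Schur multiplier -/

section Cohomology

variable {G : Type*} [Group G]

/-- The group `Z²G` of 2-cocycles of `G` with values in `ℂˣ` (trivial action). -/
def Z2 (G : Type*) [Group G] : Subgroup (G → G → ℂˣ) where
  carrier := {α | ∀ x y z, α x y * α (x * y) z = α y z * α x (y * z)}
  one_mem' := by intro x y z; simp
  mul_mem' := by
    intro α β hα hβ x y z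
    simp only [Pi.mul_apply]
    rw [mul_mul_mul_comm, hα x y z, hβ x y z, mul_mul_mul_comm]
  inv_mem' := by
    intro α hα x y z
    simp only [Pi.inv_apply]
    rw [← mul_inv, ← mul_inv, hα x y z]

/-- The coboundary `δζ(x, y) = ζ(x) ζ(y) ζ(xy)⁻¹`. -/
def delta (G : Type*) [Group G] : (G → ℂˣ) →* Z2 G where
  toFun ζ := ⟨fun x y => ζ x * ζ y / ζ (x * y), by
    intro x y z
    change ζ x * ζ y / ζ (x * y) * (ζ (x * y) * ζ z / ζ (x * y * z)) =
      ζ y * ζ z / ζ (y * z) * (ζ x * ζ (y * z) / ζ (x * (y * z)))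
    rw [mul_assoc x y z, div_mul_div_comm, div_mul_div_comm, div_eq_div_iff_mul_eq_mul]
    generalize ζ (x * (y * z)) = a
    generalize ζ (y * z) = b
    generalize ζ (x * y) = d
    ac_rfl⟩
  map_one' := by ext; simp
  map_mul' ζ ξ := by
    apply Subtype.ext
    funext x y
    simp only [Pi.mul_apply, Subgroup.coe_mul]
    rw [div_mul_div_comm, mul_mul_mul_comm]

/-- The group `B²G` of coboundaries. -/
def B2 (G : Type*) [Group G] : Subgroup (Z2 G) := (delta G).range

/-- The Schur multiplier `H²G = Z²G / B²G`. -/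
abbrev H2 (G : Type*) [Group G] : Type _ := Z2 G ⧸ B2 G

/-- The coclass `[α]` of a cocycle `α`. -/
def coclass (α : Z2 G) : H2 G := QuotientGroup.mk α

/-- Restriction of cocycles to a subgroup. -/
def resZ2 (J : Subgroup G) : Z2 G →* Z2 J where
  toFun α := ⟨fun x y => α.1 x y, fun x y z => α.2 x y z⟩
  map_one' := rfl
  map_mul' _ _ := rfl

/-- Restriction of coclasses to a subgroup. -/
def resH2 (J : Subgroup G) : H2 G →* H2 J :=
  QuotientGroup.map (B2 G) (B2 J) (resZ2 J) (by
    rintro _ ⟨ζ, rfl⟩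
    exact ⟨fun x => ζ x, rfl⟩)

/-- `c = a b` where `a = c_π` has order a `π`-number and `b = c_{π'}` has order a `π'`-number. -/
def IsPiFactorization (π : Set ℕ) (c a b : H2 G) : Prop :=
  c = a * b ∧ IsPiNumber π (orderOf a) ∧ IsPiNumber πᶜ (orderOf b)

theorem cocycle_eq (α : Z2 G) (x y z : G) :
    (α.1 x y : ℂ) * (α.1 (x * y) z : ℂ) = (α.1 y z : ℂ) * (α.1 x (y * z) : ℂ) := by
  exact_mod_cast congrArg (Units.val) (α.2 x y z)

theorem cocycle_one_left (α : Z2 G) (x : G) : α.1 1 x = α.1 1 1 := by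
  have h := α.2 1 1 x
  simp only [one_mul] at h
  exact (mul_right_cancel h).symm

end Cohomology

/-! ### Projective modules -/

section Modules

variable {G : Type*} [Group G]

/-- A map `φ : G → GL(V)` with `φ(x) φ(y) = α(x, y) φ(xy)`; that is, a section with cocycle `α` of
a projective representation of `G` on `V`, or a module over the twisted group algebra `ℂ^α G`.
A `c`-module of `G`, for `c ∈ H²G`, is such an object with `[α] = c`. -/
structure TwistedRep (α : Z2 G) (V : Type*) [AddCommGroup V] [Module ℂ V] where
  toFun : G → (V ≃ₗ[ℂ] V)
  map_mul' : ∀ (x y : G) (v : V), toFun x (toFun y v) = (α.1 x y : ℂ) • toFun (x * y) v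

namespace TwistedRep

variable {α β : Z2 G} {V W : Type*} [AddCommGroup V] [Module ℂ V] [AddCommGroup W] [Module ℂ W]

instance : CoeFun (TwistedRep α V) (fun _ => G → (V ≃ₗ[ℂ] V)) := ⟨toFun⟩

/-- Irreducible: nonzero, and the only invariant subspaces are the trivial ones. -/
def IsIrreducible (ρ : TwistedRep α V) : Prop :=
  Nontrivial V ∧ ∀ S : Submodule ℂ V, (∀ g : G, ∀ v ∈ S, ρ g v ∈ S) → S = ⊥ ∨ S = ⊤

/-- Isomorphism of `ℂ^α G`-modules. -/
def Isomorphic (ρ : TwistedRep α V) (σ : TwistedRep α W) : Prop :=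
  ∃ f : V ≃ₗ[ℂ] W, ∀ g v, f (ρ g v) = σ g (f v)

/-- Equivalence of the underlying projective representations `G → PGL(V)` and `G → PGL(W)`. -/
def ProjEquivalent (ρ : TwistedRep α V) (σ : TwistedRep β W) : Prop :=
  ∃ f : V ≃ₗ[ℂ] W, ∀ g, ∃ z : ℂˣ, ∀ v, f (ρ g v) = (z : ℂ) • σ g (f v)

/-- `ρ` and `σ` are sections of one and the same homomorphism `G → PGL(V)`. -/
def SameProj (ρ : TwistedRep α V) (σ : TwistedRep β V) : Prop :=
  ∀ g, ∃ z : ℂˣ, ∀ v, ρ g v = (z : ℂ) • σ g v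

/-- Restriction to a subgroup. -/
def res (ρ : TwistedRep α V) (J : Subgroup G) : TwistedRep (resZ2 J α) V where
  toFun j := ρ j
  map_mul' x y v := ρ.map_mul' x y v

/-- The tensor product, with the diagonal action. -/
noncomputable def tensor (ρ : TwistedRep α V) (σ : TwistedRep β W) :
    TwistedRep (α * β) (TensorProduct ℂ V W) where
  toFun g := TensorProduct.congr (ρ g) (σ g)
  map_mul' x y t := by
    induction t using TensorProduct.induction_on with
    | zero => simp
    | tmul v w =>
      simp only [TensorProduct.congr_tmul, ρ.map_mul', σ.map_mul']
      rw [TensorProduct.smul_tmul_smul]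
      simp
    | add a b ha hb => simp only [map_add, ha, hb, smul_add]

/-! The induced module `ℂ^α G ⊗_{ℂ^α J} U`: the quotient of `ℂ^α G ⊗_ℂ U = ⨁_{g ∈ G} ḡ ⊗ U` by
the relations `ḡ j̄ ⊗ u = ḡ ⊗ j u`, where `ḡ j̄` is `α(g, j)` times the basis element of `g j`. -/

section Induction

variable {J : Subgroup G} {U : Type*} [AddCommGroup U] [Module ℂ U]

/-- The relations `ḡ j̄ ⊗ u - ḡ ⊗ j u`. -/
noncomputable def indRel (σ : TwistedRep (resZ2 J α) U) : Submodule ℂ (G →₀ U) :=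
  Submodule.span ℂ {x | ∃ (g : G) (j : J) (u : U),
    x = Finsupp.single (g * j) ((α.1 g j : ℂ) • u) - Finsupp.single g (σ j u)}

/-- The space of the induced module. -/
abbrev IndSpace (σ : TwistedRep (resZ2 J α) U) : Type _ := (G →₀ U) ⧸ σ.indRel

/-- Left multiplication by the basis element of `x`: `x̄ (ḡ ⊗ u) = α(x, g) (xg ⊗ u)`. -/
noncomputable def preAct (α : Z2 G) (U : Type*) [AddCommGroup U] [Module ℂ U] (x : G) :
    (G →₀ U) →ₗ[ℂ] (G →₀ U) :=
  Finsupp.lsum ℂ fun g => (α.1 x g : ℂ) • Finsupp.lsingle (x * g)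

theorem preAct_single (x g : G) (u : U) :
    preAct α U x (Finsupp.single g u) = Finsupp.single (x * g) ((α.1 x g : ℂ) • u) := by
  simp [preAct]

theorem indRel_le (σ : TwistedRep (resZ2 J α) U) (x : G) :
    σ.indRel ≤ σ.indRel.comap (preAct α U x) := by
  refine Submodule.span_le.2 ?_
  rintro _ ⟨g, j, u, rfl⟩
  have h : preAct α U x (Finsupp.single (g * j) ((α.1 g j : ℂ) • u) - Finsupp.single g (σ j u)) =
      (α.1 x g : ℂ) • (Finsupp.single (x * g * j) ((α.1 (x * g) j : ℂ) • u)
        - Finsupp.single (x * g) (σ j u)) := by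
    rw [map_sub, preAct_single, preAct_single, smul_sub, Finsupp.smul_single, Finsupp.smul_single,
      smul_smul, smul_smul, cocycle_eq, mul_assoc x g j, mul_comm (α.1 x (g * j) : ℂ)]
  change preAct α U x _ ∈ σ.indRel
  rw [h]
  exact Submodule.smul_mem _ _ (Submodule.subset_span ⟨x * g, j, u, rfl⟩)

/-- The operator by which `x` acts on the induced module. -/
noncomputable def indAct (σ : TwistedRep (resZ2 J α) U) (x : G) :
    σ.IndSpace →ₗ[ℂ] σ.IndSpace :=
  Submodule.mapQ _ _ (preAct α U x) (σ.indRel_le x)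

theorem indAct_mul (σ : TwistedRep (resZ2 J α) U) (x y : G) (t : σ.IndSpace) :
    σ.indAct x (σ.indAct y t) = (α.1 x y : ℂ) • σ.indAct (x * y) t := by
  obtain ⟨f, rfl⟩ := Submodule.Quotient.mk_surjective _ t
  simp only [indAct, Submodule.mapQ_apply, ← Submodule.Quotient.mk_smul]
  congr 1
  induction f using Finsupp.induction_linear with
  | zero => simp
  | add a b ha hb => simp only [map_add, ha, hb, smul_add]
  | single g u =>
    rw [preAct_single, preAct_single, preAct_single, Finsupp.smul_single, smul_smul, smul_smul,
      cocycle_eq, mul_assoc x y g, mul_comm (α.1 x (y * g) : ℂ)]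

theorem indAct_one (σ : TwistedRep (resZ2 J α) U) (t : σ.IndSpace) :
    σ.indAct 1 t = (α.1 1 1 : ℂ) • t := by
  obtain ⟨f, rfl⟩ := Submodule.Quotient.mk_surjective _ t
  simp only [indAct, Submodule.mapQ_apply, ← Submodule.Quotient.mk_smul]
  congr 1
  induction f using Finsupp.induction_linear with
  | zero => simp
  | add a b ha hb => simp only [map_add, ha, hb, smul_add]
  | single g u => rw [preAct_single, Finsupp.smul_single, cocycle_one_left, one_mul]

theorem indAct_bijective (σ : TwistedRep (resZ2 J α) U) (x : G) :
    Function.Bijective (σ.indAct x) := by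
  have key : ∀ y z : G, y * z = 1 → ∀ t,
      σ.indAct y (σ.indAct z t) = ((α.1 y z * α.1 1 1 : ℂˣ) : ℂ) • t := by
    intro y z hyz t
    rw [indAct_mul, hyz, indAct_one, smul_smul, Units.val_mul]
  constructor
  · intro s t hst
    have h := congrArg (σ.indAct x⁻¹) hst
    rw [key _ _ (inv_mul_cancel x), key _ _ (inv_mul_cancel x)] at h
    exact smul_right_injective _ (Units.ne_zero _) h
  · intro t
    refine ⟨σ.indAct x⁻¹ (((α.1 x x⁻¹ * α.1 1 1 : ℂˣ) : ℂ)⁻¹ • t), ?_⟩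
    rw [key _ _ (mul_inv_cancel x), smul_smul, mul_inv_cancel₀ (Units.ne_zero _), one_smul]

/-- The module `ℂ^α G ⊗_{ℂ^α J} U` induced from `J` to `G`. -/
noncomputable def ind (σ : TwistedRep (resZ2 J α) U) : TwistedRep α σ.IndSpace where
  toFun x := LinearEquiv.ofBijective (σ.indAct x) (σ.indAct_bijective x)
  map_mul' x y t := σ.indAct_mul x y t

end Induction

/-- The `ℂ^α G`-module `ρ` is induced from the projective module `σ` of `J`: a section of `σ` is
chosen whose cocycle is the restriction of `α`, and the resulting `ℂ^α J`-module is induced. -/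
def IsInducedFrom (ρ : TwistedRep α V) (J : Subgroup G) {β : Z2 J} (σ : TwistedRep β W) : Prop :=
  ∃ τ : TwistedRep (resZ2 J α) W, SameProj τ σ ∧ ρ.Isomorphic τ.ind

end TwistedRep

/-- A `π`-decomposition `V = (V_π ⊗ V_{π'})^{cG}` of a `c`-module `V` (here `ρ`): `V_π` (here `σ`)
is an irreducible `c_π`-module and `V_{π'}` (here `τ`) an irreducible `c_{π'}`-module of the
subgroup `J`, and they restrict irreducibly to the Hall `π`-subgroups of `J`, respectively to the
Hall `π'`-subgroups of `J`. -/
structure IsPiDecomposition (π : Set ℕ) {α : Z2 G} {V : Type*} [AddCommGroup V] [Module ℂ V]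
    (ρ : TwistedRep α V) (cp cq : H2 G) (J : Subgroup G) {β γ : Z2 J}
    {Vp Vq : Type*} [AddCommGroup Vp] [Module ℂ Vp] [AddCommGroup Vq] [Module ℂ Vq]
    (σ : TwistedRep β Vp) (τ : TwistedRep γ Vq) : Prop where
  factorization : IsPiFactorization π (coclass α) cp cq
  coclass_left : coclass β = resH2 J cp
  coclass_right : coclass γ = resH2 J cq
  irreducible_left : σ.IsIrreducible
  irreducible_right : τ.IsIrreducible
  induced : ρ.IsInducedFrom J (σ.tensor τ)
  hall_left : ∀ H : Subgroup J, IsHall π H → (σ.res H).IsIrreducible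
  hall_right : ∀ H' : Subgroup J, IsHall πᶜ H' → (τ.res H').IsIrreducible

end Modules

end SchurProj

open SchurProj

/-! Existence of a decomposition rests on two reductions. Choose `J` minimal among the subgroups
with a `J`-invariant subspace `S` such that dim V = |G:J| dim S. Then `S` is irreducible and
primitive, and V is induced from `S` (`exists_primitive_subrep`, `isomorphic_ind`).

A primitive module splits along the normal series (`Primitive.piFactors`). By Clifford theory its
restriction to a normal subgroup M is isotypic. Hence V = W ⊗ X, with the operators of M generating
End W ⊗ 1. Every group element normalizes End W ⊗ 1, so by Skolem–Noether it acts as B ⊗ C. This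
makes W and X projective modules, with W irreducible on M and X scalar on M. If M is the next term
after a term N acting by scalars on V, and M/N is a π-group, a Hall π-subgroup H satisfies M = (H ∩
M)N, so W is already irreducible on H ∩ M and joins the π-factor; for a π'-group the roles are
exchanged. The factor X is again irreducible and primitive, and the argument continues on it with M
now scalar.

The numerical statements come from two facts. The degree of an irreducible projective representation
divides the group order (`IsIrreducible.finrank_dvd_card`); applied to Hall subgroups of J, it makes
dim V_π a π-number and dim V_π' a π'-number. Determinants show that the order of a coclass divides
the degree of each of its modules; with the uniqueness of the factorization c = c_π c_π', this
identifies the coclasses of the two tensor factors. The rest is the formula dim V = |G:J| dim V_π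
dim V_π', together with the fact that tensoring with a one-dimensional module changes nothing
projectively. -/

namespace SchurProj

/-! ### Arithmetic of `π`-numbers -/

section Arithmetic

variable {π : Set ℕ} {m n : ℕ}

theorem IsPiNumber.of_dvd (h : IsPiNumber π n) (hmn : m ∣ n) : IsPiNumber π m :=
  ⟨fun h0 => h.1 (by simpa [h0] using hmn), fun p hp hpm => h.2 p hp (hpm.trans hmn)⟩

theorem isPiNumber_one : IsPiNumber π 1 :=
  ⟨one_ne_zero, fun _ hp h => absurd (Nat.dvd_one.1 h) hp.ne_one⟩

theorem IsPiNumber.mul (hm : IsPiNumber π m) (hn : IsPiNumber π n) : IsPiNumber π (m * n) :=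
  ⟨mul_ne_zero hm.1 hn.1, fun p hp h => (hp.dvd_mul.1 h).elim (hm.2 p hp) (hn.2 p hp)⟩

theorem IsPiNumber.coprime (hm : IsPiNumber π m) (hn : IsPiNumber πᶜ n) : m.Coprime n :=
  Nat.coprime_of_dvd fun p hp hpm hpn => hn.2 p hp hpn (hm.2 p hp hpm)

theorem IsPiNumber.eq_one (hm : IsPiNumber π m) (hm' : IsPiNumber πᶜ m) : m = 1 :=
  (Nat.coprime_self m).1 (hm.coprime hm')

theorem piPart_eq_prod (π : Set ℕ) [DecidablePred (· ∈ π)] (n : ℕ) :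
    piPart π n = n.factorization.prod fun p k => if p ∈ π then p ^ k else 1 := by
  rw [piPart, Finset.prod_filter, Finsupp.prod, Nat.support_factorization]
  congr! 2

theorem piPart_mul (π : Set ℕ) (hm : m ≠ 0) (hn : n ≠ 0) :
    piPart π (m * n) = piPart π m * piPart π n := by
  classical
  rw [piPart_eq_prod, piPart_eq_prod, piPart_eq_prod, Nat.factorization_mul hm hn,
    Finsupp.prod_add_index']
  · intro p; simp
  · intro p a b
    split_ifs
    · rw [pow_add]
    · rw [one_mul]

theorem IsPiNumber.piPart_eq (h : IsPiNumber π n) : piPart π n = n := by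
  classical
  conv_rhs => rw [← Nat.prod_factorization_pow_eq_self h.1]
  rw [piPart_eq_prod]
  refine Finset.prod_congr rfl fun p hp => ?_
  rw [Nat.support_factorization] at hp
  exact if_pos (h.2 p (Nat.prime_of_mem_primeFactors hp) (Nat.dvd_of_mem_primeFactors hp))

theorem piPart_eq_one_iff (hn : n ≠ 0) : piPart π n = 1 ↔ IsPiNumber πᶜ n := by
  classical
  constructor
  · refine fun h => ⟨hn, fun p hp hpn hpi => ?_⟩
    rw [piPart, Finset.prod_eq_one_iff_of_one_le'] at h
    · have h1 := h p (Finset.mem_filter.2 ⟨Nat.mem_primeFactors.2 ⟨hp, hpn, hn⟩, hpi⟩)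
      rw [Nat.pow_eq_one] at h1
      rcases h1 with h1 | h1
      · exact hp.ne_one h1
      · exact (hp.factorization_pos_of_dvd hn hpn).ne' h1
    · intro q hq
      exact Nat.one_le_pow _ _ (Nat.prime_of_mem_primeFactors (Finset.mem_filter.1 hq).1).pos
  · intro h
    rw [piPart, Finset.filter_eq_empty_iff.2, Finset.prod_empty]
    exact fun p hp hpi =>
      h.2 p (Nat.prime_of_mem_primeFactors hp) (Nat.dvd_of_mem_primeFactors hp) hpi

end Arithmetic

/-! ### Hall subgroups of separable groups -/

section Groups

variable {G : Type*} [Group G] {π : Set ℕ}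

theorem IsPiSeparable.compl (h : IsPiSeparable π G) : IsPiSeparable πᶜ G := by
  obtain ⟨l, N, h0, hl, hn, hs⟩ := h
  refine ⟨l, N, h0, hl, hn, fun i hi => ⟨(hs i hi).1, ?_⟩⟩
  rw [compl_compl]
  exact (hs i hi).2.symm

theorem IsPiSeparable.subgroup (h : IsPiSeparable π G) (J : Subgroup G) : IsPiSeparable π J := by
  obtain ⟨l, N, h0, hl, hn, hs⟩ := h
  refine ⟨l, fun i => (N i).subgroupOf J, ?_, ?_, fun i => ?_, fun i hi => ?_⟩
  · simp [h0]
  · simp [hl]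
  · have := hn i
    infer_instance
  · have := hn i
    refine ⟨Subgroup.comap_mono (hs i hi).1, ?_⟩
    have hd : ((N i).subgroupOf J).relIndex ((N (i + 1)).subgroupOf J) ∣
        (N i).relIndex (N (i + 1)) := by
      have h1 : ((N i).subgroupOf J).relIndex ((N (i + 1)).subgroupOf J) =
          (N i).relIndex (N (i + 1) ⊓ J) := by
        rw [Subgroup.subgroupOf, Subgroup.relIndex_comap, Subgroup.subgroupOf_map_subtype]
      rw [h1, ← Subgroup.relIndex_subgroupOf (inf_le_left : N (i + 1) ⊓ J ≤ N (i + 1))]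
      exact Subgroup.relIndex_dvd_index_of_normal _ _
    exact (hs i hi).2.imp (·.of_dvd hd) (·.of_dvd hd)

/-- Schur–Zassenhaus for M/N in G/N, pulled back to G. -/
theorem exists_complement_above [Finite G] {N M : Subgroup G} [N.Normal] [M.Normal] (hNM : N ≤ M)
    (hc : (N.relIndex M).Coprime M.index) :
    ∃ C : Subgroup G, N ≤ C ∧ N.relIndex C = M.index ∧ C.index = N.relIndex M := by
  set q := QuotientGroup.mk' N
  have hq : Function.Surjective q := QuotientGroup.mk'_surjective N
  have hker : q.ker = N := QuotientGroup.ker_mk' N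
  have : (M.map q).Normal := Subgroup.Normal.map inferInstance q hq
  have hcard : Nat.card (M.map q) = N.relIndex M := by rw [← Subgroup.relIndex_ker, hker]
  have hindex : (M.map q).index = M.index := by
    rw [Subgroup.index_map_eq _ hq (by rwa [hker])]
  obtain ⟨C, hC⟩ := Subgroup.exists_right_complement'_of_coprime (N := M.map q)
    (by rwa [hcard, hindex])
  have hNC : N ≤ C.comap q := by
    exact hker.symm.le.trans (Subgroup.ker_le_comap q C)
  refine ⟨C.comap q, hNC, ?_, ?_⟩
  · have h1 := Subgroup.relIndex_ker (C.comap q) q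
    rw [hker, Subgroup.map_comap_eq_self_of_surjective hq] at h1
    rw [h1, ← hindex, hC.symm.index_eq_card]
  · rw [Subgroup.index_comap_of_surjective _ hq, hC.index_eq_card, hcard]

theorem IsPiSeparable.exists_hall [Finite G] (h : IsPiSeparable π G) :
    ∃ H : Subgroup G, IsHall π H := by
  obtain ⟨l, N, h0, hl, hn, hs⟩ := h
  -- Descend the series from G, keeping K of π'-index whose quotient by the current term is a
  -- π-group. A π-factor leaves K unchanged; a π'-factor is removed by passing to a complement
  -- inside K.
  have key : ∀ k ≤ l, ∃ K : Subgroup G, N (l - k) ≤ K ∧ IsPiNumber π ((N (l - k)).relIndex K) ∧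
      IsPiNumber πᶜ K.index := by
    intro k
    induction k with
    | zero =>
      intro _
      refine ⟨⊤, le_top, ?_, ?_⟩
      · simpa [hl] using isPiNumber_one
      · simpa using isPiNumber_one
    | succ k ih =>
      intro hk
      obtain ⟨K, hNK, h1, h2⟩ := ih (by omega)
      obtain ⟨i, hi⟩ : ∃ i, i = l - (k + 1) := ⟨_, rfl⟩
      have hi1 : l - k = i + 1 := by omega
      rw [← hi]
      rw [hi1] at hNK h1
      have hle := (hs i (by omega)).1
      have hni := hn i
      have hni1 := hn (i + 1)
      rcases (hs i (by omega)).2 with h3 | h3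
      · refine ⟨K, hle.trans hNK, ?_, h2⟩
        rw [← Subgroup.relIndex_mul_relIndex _ _ _ hle hNK]
        exact h3.mul h1
      · obtain ⟨C, hC1, hC2, hC3⟩ := exists_complement_above (G := K)
          (N := (N i).subgroupOf K) (M := (N (i + 1)).subgroupOf K) (Subgroup.comap_mono hle) (by
            rw [Subgroup.relIndex_subgroupOf hNK]
            exact (h1.coprime h3).symm)
        rw [Subgroup.relIndex_subgroupOf hNK] at hC3
        have hmap : (N i).subgroupOf K = (N i ⊓ K).subgroupOf K := by simp
        refine ⟨C.map K.subtype, ?_, ?_, ?_⟩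
        · rw [← inf_eq_left.2 (hle.trans hNK), ← Subgroup.subgroupOf_map_subtype]
          exact Subgroup.map_mono hC1
        · rw [← Subgroup.relIndex_comap]
          change IsPiNumber π (((N i).subgroupOf K).relIndex C)
          rw [hC2]
          exact h1
        · rw [Subgroup.index_map_subtype, hC3]
          exact h3.mul h2
  obtain ⟨K, -, h1, h2⟩ := key l le_rfl
  refine ⟨K, ?_, h2⟩
  rwa [Nat.sub_self, h0, Subgroup.relIndex_bot_left] at h1

/-- The index of (H ∩ M)N in M divides |M:N|, a π-number, and also |M : H ∩ M| = |HM : H|, a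
π'-number; so it is 1. -/
theorem IsHall.le_inf_sup [Finite G] {H M N : Subgroup G} [M.Normal] [N.Normal] (hH : IsHall π H)
    (hNM : N ≤ M) (h : IsPiNumber π (N.relIndex M)) : M ≤ (H ⊓ M) ⊔ N := by
  have hK : (H ⊓ M) ⊔ N ≤ M := sup_le inf_le_right hNM
  rw [← Subgroup.relIndex_eq_one]
  refine IsPiNumber.eq_one (π := π) (h.of_dvd ?_) (hH.2.of_dvd ?_)
  · exact Subgroup.relIndex_dvd_of_le_left _ le_sup_right
  · refine (Subgroup.relIndex_dvd_of_le_left M (le_sup_left : H ⊓ M ≤ _)).trans ?_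
    rw [Subgroup.inf_relIndex_right]
    have : H.relIndex M = H.relIndex (H ⊔ M) := by
      have e1 := Subgroup.relIndex_mul_relIndex (H ⊓ M) H (H ⊔ M) inf_le_left le_sup_left
      have e2 := Subgroup.relIndex_mul_relIndex (H ⊓ M) M (H ⊔ M) inf_le_right le_sup_right
      rw [Subgroup.inf_relIndex_left] at e1
      rw [Subgroup.inf_relIndex_right, Subgroup.relIndex_sup_right, mul_comm, ← e1] at e2
      exact Nat.eq_of_mul_eq_mul_left
        (Nat.pos_of_ne_zero fun h0 =>
          Subgroup.index_ne_zero_of_finite (Subgroup.index_eq_zero_of_relIndex_eq_zero h0)) e2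
    rw [this]
    exact Dvd.intro _ (Subgroup.relIndex_mul_index le_sup_left)

theorem IsHall.map_subtype {J : Subgroup G} {H : Subgroup J} (hH : IsHall π H)
    (hJ : IsPiNumber πᶜ J.index) : IsHall π (H.map J.subtype) := by
  refine ⟨?_, ?_⟩
  · rw [Nat.card_congr (H.equivMapOfInjective _ J.subtype_injective).toEquiv.symm]
    exact hH.1
  · rw [Subgroup.index_map_subtype]
    exact hH.2.mul hJ

end Groups

/-! ### `π`-parts of elements of abelian groups -/

section PiElements

variable {π : Set ℕ} {A : Type*} [CommGroup A] {a b a' b' : A}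

theorem exists_piNumber_mul {n : ℕ} (π : Set ℕ) (hn : n ≠ 0) :
    ∃ m k, n = m * k ∧ IsPiNumber π m ∧ IsPiNumber πᶜ k := by
  induction n using Nat.recOnMul with
  | zero => exact absurd rfl hn
  | one => exact ⟨1, 1, rfl, isPiNumber_one, isPiNumber_one⟩
  | prime p hp =>
    have key : ∀ σ : Set ℕ, p ∈ σ → IsPiNumber σ p := fun σ h =>
      ⟨hn, fun q hq hqp => by rwa [(Nat.prime_dvd_prime_iff_eq hq hp).1 hqp]⟩
    by_cases h : p ∈ π
    · exact ⟨p, 1, (mul_one p).symm, key π h, isPiNumber_one⟩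
    · exact ⟨1, p, (one_mul p).symm, isPiNumber_one, key πᶜ h⟩
  | mul x y hx hy =>
    obtain ⟨m, k, rfl, hm, hk⟩ := hx (left_ne_zero_of_mul hn)
    obtain ⟨m', k', rfl, hm', hk'⟩ := hy (right_ne_zero_of_mul hn)
    exact ⟨m * m', k * k', mul_mul_mul_comm _ _ _ _, hm.mul hm', hk.mul hk'⟩

theorem IsPiNumber.orderOf_mul (ha : IsPiNumber π (orderOf a)) (hb : IsPiNumber π (orderOf b)) :
    IsPiNumber π (orderOf (a * b)) :=
  (ha.mul hb).of_dvd ((Commute.all a b).orderOf_mul_dvd_mul_orderOf)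

/-- The element a a'⁻¹ = b' b⁻¹ has an order that is both a π-number and a π'-number. -/
theorem eq_of_mul_eq_mul_of_isPiNumber (h : a * b = a' * b') (ha : IsPiNumber π (orderOf a))
    (ha' : IsPiNumber π (orderOf a')) (hb : IsPiNumber πᶜ (orderOf b))
    (hb' : IsPiNumber πᶜ (orderOf b')) : a = a' ∧ b = b' := by
  have h1 : a * a'⁻¹ = b' * b⁻¹ := by
    rw [← div_eq_mul_inv, ← div_eq_mul_inv, div_eq_div_iff_mul_eq_mul, h, mul_comm]
  have h2 : orderOf (a * a'⁻¹) = 1 :=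
    (ha.orderOf_mul (b := a'⁻¹) (by rwa [orderOf_inv])).eq_one (by
      rw [h1]
      exact hb'.orderOf_mul (by rwa [orderOf_inv]))
  have h3 : a = a' := mul_inv_eq_one.1 (orderOf_eq_one_iff.1 h2)
  subst h3
  exact ⟨rfl, mul_left_cancel h⟩

theorem exists_pi_decomposition_of_pow_eq_one (π : Set ℕ) {c : A} {n : ℕ} (hn : n ≠ 0)
    (hc : c ^ n = 1) :
    ∃ a b : A, c = a * b ∧ IsPiNumber π (orderOf a) ∧ IsPiNumber πᶜ (orderOf b) := by
  obtain ⟨m, k, rfl, hm, hk⟩ := exists_piNumber_mul π hn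
  -- The Bézout coefficients of the coprime π- and π'-parts of n give the exponents of the two
  -- components of c.
  have hmk : (m : ℤ) * m.gcdA k + k * m.gcdB k = 1 := by
    rw [← Nat.gcd_eq_gcd_ab, hm.coprime hk, Nat.cast_one]
  have hc' : c ^ ((m : ℤ) * k) = 1 := by exact_mod_cast hc
  refine ⟨c ^ ((k : ℤ) * m.gcdB k), c ^ ((m : ℤ) * m.gcdA k), ?_, hm.of_dvd ?_, hk.of_dvd ?_⟩
  · rw [← zpow_add, add_comm, hmk, zpow_one]
  · rw [orderOf_dvd_iff_pow_eq_one, ← zpow_natCast, ← zpow_mul,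
      show (k : ℤ) * m.gcdB k * m = m * k * m.gcdB k by ring, zpow_mul, hc', one_zpow]
  · rw [orderOf_dvd_iff_pow_eq_one, ← zpow_natCast, ← zpow_mul,
      show (m : ℤ) * m.gcdA k * k = m * k * m.gcdA k by ring, zpow_mul, hc', one_zpow]

end PiElements

/-! ### Orders of coclasses -/

section Coclasses

variable {G : Type*} [Group G]

theorem coclass_eq_one_iff {α : Z2 G} : coclass α = 1 ↔ ∃ ζ : G → ℂˣ, delta G ζ = α :=
  QuotientGroup.eq_one_iff α

theorem coclass_mul (α β : Z2 G) : coclass (α * β) = coclass α * coclass β := rfl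

theorem coclass_pow (α : Z2 G) (n : ℕ) : coclass (α ^ n) = coclass α ^ n := rfl

theorem resH2_coclass (J : Subgroup G) (α : Z2 G) : resH2 J (coclass α) = coclass (resZ2 J α) := rfl

theorem Z2.ext {α β : Z2 G} (h : ∀ x y, α.1 x y = β.1 x y) : α = β :=
  Subtype.ext (funext fun x => funext (h x))

theorem cocycle_one_right (α : Z2 G) (x : G) : α.1 x 1 = α.1 1 1 := by
  have h := α.2 x 1 1
  simp only [mul_one] at h
  exact mul_right_cancel h

/-- Multiplying the cocycle identity over its last argument exhibits α^|G| as the coboundary of x ↦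
∏ α(x, y). -/
theorem pow_card_eq_one [Finite G] (c : H2 G) : c ^ Nat.card G = 1 := by
  have := Fintype.ofFinite G
  obtain ⟨α, rfl⟩ := QuotientGroup.mk_surjective c
  refine (coclass_pow α _).symm.trans (coclass_eq_one_iff.2 ⟨fun x => ∏ y, α.1 x y, ?_⟩)
  refine Z2.ext fun x y => ?_
  change (∏ z, α.1 x z) * (∏ z, α.1 y z) / ∏ z, α.1 (x * y) z = α.1 x y ^ Nat.card G
  have h1 : ∏ z, α.1 x (y * z) = ∏ z, α.1 x z :=
    Fintype.prod_equiv (Equiv.mulLeft y) _ _ fun z => rfl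
  have h2 : (∏ _z : G, α.1 x y) = α.1 x y ^ Nat.card G := by
    rw [Finset.prod_const, Finset.card_univ, Nat.card_eq_fintype_card]
  rw [div_eq_iff_eq_mul, ← h1, ← h2, mul_comm, ← Finset.prod_mul_distrib, ← Finset.prod_mul_distrib]
  exact Finset.prod_congr rfl fun z _ => (α.2 x y z).symm

variable {α : Z2 G} {V : Type*} [AddCommGroup V] [Module ℂ V]

theorem TwistedRep.comp_eq (ρ : TwistedRep α V) (x y : G) :
    (ρ x : V →ₗ[ℂ] V) ∘ₗ (ρ y : V →ₗ[ℂ] V) = (α.1 x y : ℂ) • (ρ (x * y) : V →ₗ[ℂ] V) :=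
  LinearMap.ext (ρ.map_mul' x y)

/-- Determinants of ρ(x)ρ(y) = α(x, y)ρ(xy) show that α^(dim V) is the coboundary of det ρ. -/
theorem TwistedRep.coclass_pow_finrank (ρ : TwistedRep α V) :
    coclass α ^ Module.finrank ℂ V = 1 := by
  rw [← coclass_pow, coclass_eq_one_iff]
  refine ⟨fun x => LinearEquiv.det (ρ x), Z2.ext fun x y => Units.ext ?_⟩
  change ((LinearEquiv.det (ρ x) * LinearEquiv.det (ρ y) / LinearEquiv.det (ρ (x * y)) : ℂˣ) : ℂ) =
    ((α.1 x y ^ Module.finrank ℂ V : ℂˣ) : ℂ)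
  rw [Units.val_div_eq_div_val, div_eq_iff (Units.ne_zero _), Units.val_mul, LinearEquiv.coe_det,
    LinearEquiv.coe_det, LinearEquiv.coe_det, ← LinearMap.det_comp, ρ.comp_eq, LinearMap.det_smul,
    Units.val_pow_eq_pow_val]

theorem TwistedRep.isPiNumber_orderOf {π : Set ℕ} (ρ : TwistedRep α V)
    (h : IsPiNumber π (Module.finrank ℂ V)) : IsPiNumber π (orderOf (coclass α)) :=
  h.of_dvd (orderOf_dvd_of_pow_eq_one ρ.coclass_pow_finrank)

theorem eq_one_of_isPiNumber [Finite G] {π : Set ℕ} {c : H2 G} (hG : IsPiNumber π (Nat.card G))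
    (hc : IsPiNumber πᶜ (orderOf c)) : c = 1 :=
  orderOf_eq_one_iff.1
    (IsPiNumber.eq_one (hG.of_dvd (orderOf_dvd_of_pow_eq_one (pow_card_eq_one c))) hc)

theorem exists_isPiFactorization [Finite G] (π : Set ℕ) (c : H2 G) :
    ∃ a b, IsPiFactorization π c a b :=
  exists_pi_decomposition_of_pow_eq_one (A := H2 G) π (Nat.card_pos (α := G)).ne'
    (pow_card_eq_one c)

theorem IsPiFactorization.unique {π : Set ℕ} {c a b a' b' : H2 G} (h : IsPiFactorization π c a b)
    (h' : IsPiFactorization π c a' b') : a = a' ∧ b = b' :=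
  eq_of_mul_eq_mul_of_isPiNumber (A := H2 G) (h.1.symm.trans h'.1) h.2.1 h'.2.1 h.2.2 h'.2.2

theorem orderOf_resH2_dvd (J : Subgroup G) (c : H2 G) : orderOf (resH2 J c) ∣ orderOf c :=
  orderOf_map_dvd (resH2 J) c

theorem IsPiFactorization.res {π : Set ℕ} {c a b : H2 G} (h : IsPiFactorization π c a b)
    (J : Subgroup G) : IsPiFactorization π (resH2 J c) (resH2 J a) (resH2 J b) :=
  ⟨(congrArg (resH2 J) h.1).trans (map_mul (resH2 J) a b), h.2.1.of_dvd (orderOf_resH2_dvd J a),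
    h.2.2.of_dvd (orderOf_resH2_dvd J b)⟩

theorem IsPiFactorization.eq_one_left {π : Set ℕ} {c a b : H2 G} (h : IsPiFactorization π c a b)
    (hc : IsPiNumber πᶜ (orderOf c)) : a = 1 := by
  have h1 : IsPiFactorization π c (1 : H2 G) c :=
    ⟨(one_mul c).symm, by rw [orderOf_one]; exact isPiNumber_one, hc⟩
  exact (h.unique h1).1

end Coclasses

open TensorProduct

/-! ### Endomorphisms of tensor products -/

section LinearAlgebra

variable {W X : Type*} [AddCommGroup W] [Module ℂ W] [AddCommGroup X] [Module ℂ X]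

/-- Burnside's theorem on irreducible matrix algebras. -/
theorem subalgebra_eq_top_of_irreducible [FiniteDimensional ℂ W] [Nontrivial W]
    (A : Subalgebra ℂ (Module.End ℂ W))
    (h : ∀ S : Submodule ℂ W, (∀ a ∈ A, ∀ v ∈ S, a v ∈ S) → S = ⊥ ∨ S = ⊤) : A = ⊤ := by
  have hs : IsSimpleModule A W :=
    { exists_pair_ne := exists_pair_ne _
      eq_bot_or_eq_top := fun S => by
        have := h (S.restrictScalars ℂ) fun a ha v hv => S.smul_mem (⟨a, ha⟩ : A) hv
        simpa using this }
  classical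
  have hb := IsSimpleModule.algebraMap_end_bijective_of_isAlgClosed ℂ (A := A) (V := W)
  rw [eq_top_iff]
  intro f _
  -- By Schur's lemma End_A W consists of scalars, so any linear f commutes with it; density on a
  -- finite basis then puts f in A.
  let f' : Module.End (Module.End A W) W :=
    { toFun := f
      map_add' := f.map_add
      map_smul' := fun t v => by
        obtain ⟨z, rfl⟩ := hb.2 t
        exact f.map_smul z v }
  let b := Module.finBasis ℂ W
  obtain ⟨r, hr⟩ := jacobson_density f' (Finset.univ.image b)
  have : f = r.1 := b.ext fun i => hr (b i) (Finset.mem_image_of_mem _ (Finset.mem_univ i))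
  rw [this]
  exact r.2

/-- Contraction of the first factor of a tensor product with a functional. -/
noncomputable def contract (φ : Module.Dual ℂ W) : W ⊗[ℂ] X →ₗ[ℂ] X :=
  (TensorProduct.lid ℂ X).toLinearMap ∘ₗ φ.rTensor X

@[simp] theorem contract_tmul (φ : Module.Dual ℂ W) (w : W) (x : X) :
    contract φ (w ⊗ₜ x) = φ w • x := by
  simp [contract]

theorem rTensor_smulRight (φ : Module.Dual ℂ W) (w : W) (t : W ⊗[ℂ] X) :
    (φ.smulRight w).rTensor X t = w ⊗ₜ contract φ t := by
  induction t with
  | zero => simp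
  | tmul w' x => simp [TensorProduct.smul_tmul]
  | add a b ha hb => rw [map_add, ha, hb, map_add, TensorProduct.tmul_add]

theorem eq_zero_of_contract_eq_zero [FiniteDimensional ℂ W] {t : W ⊗[ℂ] X}
    (h : ∀ φ : Module.Dual ℂ W, contract φ t = 0) : t = 0 := by
  let b := Module.finBasis ℂ W
  have key : ∀ t : W ⊗[ℂ] X, ∑ i, b i ⊗ₜ[ℂ] contract (b.coord i) t = t := by
    intro t
    induction t with
    | zero => simp
    | tmul w x =>
      simp_rw [contract_tmul, ← TensorProduct.smul_tmul, ← TensorProduct.sum_tmul]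
      congr 1
      exact b.sum_repr w
    | add s t hs ht =>
      simp_rw [map_add, TensorProduct.tmul_add, Finset.sum_add_distrib, hs, ht]
  rw [← key t]
  exact Finset.sum_eq_zero fun i _ => by rw [h, TensorProduct.tmul_zero]

theorem tmul_left_injective {w : W} (hw : w ≠ 0) :
    Function.Injective fun x : X => w ⊗ₜ[ℂ] x := by
  obtain ⟨φ, hφ⟩ := Module.Projective.exists_dual_eq_one ℂ hw
  intro x y hxy
  simpa [hφ] using congrArg (contract φ) hxy

/-- The centralizer of End W ⊗ 1 is 1 ⊗ End X: a rank-one operator moves w₀ to any w, so T on the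
slice w₀ ⊗ X determines T. -/
theorem exists_lTensor_eq [Nontrivial W] (T : W ⊗[ℂ] X →ₗ[ℂ] W ⊗[ℂ] X)
    (hT : ∀ (A : Module.End ℂ W) t, T (A.rTensor X t) = A.rTensor X (T t)) :
    ∃ C : Module.End ℂ X, ∀ w x, T (w ⊗ₜ x) = w ⊗ₜ C x := by
  obtain ⟨w₀, hw₀⟩ := exists_ne (0 : W)
  obtain ⟨φ, hφ⟩ := Module.Projective.exists_dual_eq_one ℂ hw₀
  refine ⟨contract φ ∘ₗ T ∘ₗ TensorProduct.mk ℂ W X w₀, fun w x => ?_⟩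
  have h := hT (φ.smulRight w) (w₀ ⊗ₜ x)
  rw [rTensor_smulRight, rTensor_smulRight, contract_tmul, hφ, one_smul] at h
  exact h

/-- Conjugation by T is an automorphism of End W, hence inner, given by some B. Then (B ⊗ 1)⁻¹T
centralizes End W ⊗ 1, so it is 1 ⊗ C. -/
theorem exists_tensor_congr_eq [FiniteDimensional ℂ W] [FiniteDimensional ℂ X] [Nontrivial W]
    [Nontrivial X] (T : W ⊗[ℂ] X ≃ₗ[ℂ] W ⊗[ℂ] X)
    (hT : ∀ A : Module.End ℂ W, ∃ A' : Module.End ℂ W,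
      ∀ t, T (A.rTensor X t) = A'.rTensor X (T t)) :
    ∃ (B : W ≃ₗ[ℂ] W) (C : X ≃ₗ[ℂ] X), ∀ t, T t = TensorProduct.congr B C t := by
  obtain ⟨x₀, hx₀⟩ := exists_ne (0 : X)
  obtain ⟨w₀, hw₀⟩ := exists_ne (0 : W)
  have hinj : Function.Injective fun A : Module.End ℂ W => A.rTensor X := by
    intro A A' h
    ext w
    have h1 := congrArg (TensorProduct.comm ℂ W X) (LinearMap.congr_fun h (w ⊗ₜ x₀))
    exact tmul_left_injective hx₀ h1
  choose Φ hΦ using hT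
  have hΦ' : ∀ A A', (∀ t, T (A.rTensor X t) = A'.rTensor X (T t)) → Φ A = A' := by
    intro A A' h
    refine hinj (LinearMap.ext fun t => ?_)
    obtain ⟨s, rfl⟩ := T.surjective t
    exact (hΦ A s).symm.trans (h s)
  let F : Module.End ℂ W →ₐ[ℂ] Module.End ℂ W :=
    { toFun := Φ
      map_one' := hΦ' _ _ fun t => by
        rw [Module.End.one_eq_id, LinearMap.rTensor_id, LinearMap.id_apply, LinearMap.id_apply]
      map_zero' := hΦ' _ _ fun t => by simp
      map_mul' := fun A A' => hΦ' _ _ fun t => by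
        rw [LinearMap.rTensor_mul, LinearMap.rTensor_mul, Module.End.mul_apply,
          Module.End.mul_apply, hΦ, hΦ]
      map_add' := fun A A' => hΦ' _ _ fun t => by
        rw [LinearMap.rTensor_add, LinearMap.rTensor_add, LinearMap.add_apply,
          LinearMap.add_apply, map_add, hΦ, hΦ]
      commutes' := fun z => hΦ' _ _ fun t => by
        rw [Algebra.algebraMap_eq_smul_one, LinearMap.rTensor_smul, Module.End.one_eq_id,
          LinearMap.rTensor_id, LinearMap.smul_apply, LinearMap.smul_apply, map_smul,
          LinearMap.id_apply, LinearMap.id_apply] }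
  have hF : Function.Injective F := by
    intro A A' h
    refine hinj (LinearMap.ext fun t => T.injective ?_)
    rw [hΦ, hΦ]
    exact congrArg (fun E : Module.End ℂ W => E.rTensor X (T t)) h
  obtain ⟨B, hB⟩ := AlgEquiv.eq_linearEquivConjAlgEquiv (AlgEquiv.ofBijective F
    ⟨hF, (LinearMap.injective_iff_surjective (f := F.toLinearMap)).1 hF⟩)
  have hB' : ∀ A : Module.End ℂ W, ∀ w, B (A w) = Φ A (B w) := by
    intro A w
    have h := LinearMap.congr_fun (AlgEquiv.congr_fun hB A) (B w)
    change Φ A (B w) = _ at h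
    rw [h]
    simp [LinearEquiv.conjAlgEquiv_apply]
  have hBt : ∀ (A : Module.End ℂ W) t, TensorProduct.congr B (LinearEquiv.refl ℂ X)
      (A.rTensor X t) = (Φ A).rTensor X (TensorProduct.congr B (LinearEquiv.refl ℂ X) t) := by
    intro A t
    induction t with
    | zero => simp
    | tmul w x => simp [hB']
    | add a b ha hb => simp only [map_add, ha, hb]
  obtain ⟨C, hC⟩ := exists_lTensor_eq
    ((TensorProduct.congr B (LinearEquiv.refl ℂ X)).symm.toLinearMap ∘ₗ T.toLinearMap) (by
      intro A t
      simp only [LinearMap.comp_apply, LinearEquiv.coe_coe]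
      rw [LinearEquiv.symm_apply_eq, hBt, LinearEquiv.apply_symm_apply, hΦ])
  have hC' : ∀ w x, T (w ⊗ₜ x) = B w ⊗ₜ C x := by
    intro w x
    have h := hC w x
    simp only [LinearMap.comp_apply, LinearEquiv.coe_coe] at h
    rw [LinearEquiv.symm_apply_eq] at h
    rw [h, TensorProduct.congr_tmul, LinearEquiv.refl_apply]
  have hCinj : Function.Injective C := by
    intro x y hxy
    refine tmul_left_injective hw₀ (T.injective ?_)
    rw [hC', hC', hxy]
  refine ⟨B, LinearEquiv.ofInjectiveEndo C hCinj, fun t => ?_⟩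
  induction t with
  | zero => simp
  | tmul w x => rw [hC', TensorProduct.congr_tmul]; rfl
  | add a b ha hb => rw [map_add, ha, hb, map_add]

/-- The factors of an operator A ⊗ C are unique up to inverse scalars; contracting with a functional
equal to 1 at C x₀ reads off the scalar. -/
theorem exists_scalar_of_tmul_eq [Nontrivial W] [Nontrivial X] (A : W ≃ₗ[ℂ] W)
    (A' : W →ₗ[ℂ] W) (C : X ≃ₗ[ℂ] X) (C' : X →ₗ[ℂ] X) (h : ∀ w x, A w ⊗ₜ[ℂ] C x = A' w ⊗ₜ[ℂ] C' x) :
    ∃ z : ℂˣ, (∀ w, A w = (z : ℂ) • A' w) ∧ ∀ x, (z : ℂ) • C x = C' x := by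
  obtain ⟨x₀, hx₀⟩ := exists_ne (0 : X)
  obtain ⟨w₀, hw₀⟩ := exists_ne (0 : W)
  obtain ⟨ψ, hψ⟩ := Module.Projective.exists_dual_eq_one ℂ ((map_ne_zero_iff C C.injective).2 hx₀)
  have hA : ∀ w, A w = ψ (C' x₀) • A' w := by
    intro w
    have h1 := congrArg (fun t => contract ψ (TensorProduct.comm ℂ W X t)) (h w x₀)
    simpa [hψ] using h1
  have hAw := (map_ne_zero_iff A A.injective).2 hw₀
  rw [hA] at hAw
  refine ⟨Units.mk0 _ (left_ne_zero_of_smul hAw), hA, fun x => ?_⟩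
  refine tmul_left_injective (right_ne_zero_of_smul hAw) ?_
  simp only [Units.val_mk0]
  rw [← h, hA w₀, TensorProduct.tmul_smul, TensorProduct.smul_tmul']

end LinearAlgebra

namespace TwistedRep

variable {G : Type*} [Group G] {α : Z2 G} {V : Type*} [AddCommGroup V] [Module ℂ V]

/-! ### Irreducibility on subgroups -/

/-- The subspace `S` is invariant under the elements of `K`. -/
def Inv (ρ : TwistedRep α V) (K : Subgroup G) (S : Submodule ℂ V) : Prop :=
  ∀ g ∈ K, ∀ v ∈ S, ρ g v ∈ S

/-- The restriction to `K` is irreducible. -/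
def IrrOn (ρ : TwistedRep α V) (K : Subgroup G) : Prop :=
  Nontrivial V ∧ ∀ S : Submodule ℂ V, ρ.Inv K S → S = ⊥ ∨ S = ⊤

theorem irrOn_top {ρ : TwistedRep α V} : ρ.IrrOn ⊤ ↔ ρ.IsIrreducible :=
  and_congr_right fun _ => forall_congr' fun _ => by simp [Inv]

theorem isIrreducible_res {ρ : TwistedRep α V} {K : Subgroup G} :
    (ρ.res K).IsIrreducible ↔ ρ.IrrOn K :=
  and_congr_right fun _ => forall_congr' fun _ =>
    ⟨fun h h' => h fun g v hv => h' g g.2 v hv, fun h h' => h fun g hg v hv => h' ⟨g, hg⟩ v hv⟩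

theorem IrrOn.mono {ρ : TwistedRep α V} {K L : Subgroup G} (h : ρ.IrrOn K) (hKL : K ≤ L) :
    ρ.IrrOn L :=
  ⟨h.1, fun S hS => h.2 S fun g hg => hS g (hKL hg)⟩

/-- Burnside's theorem in the form of an induction principle: the operators of K generate End V. -/
theorem IrrOn.induction [FiniteDimensional ℂ V] {ρ : TwistedRep α V} {K : Subgroup G}
    (h : ρ.IrrOn K) {P : Module.End ℂ V → Prop} (mem : ∀ g ∈ K, P (ρ g).toLinearMap)
    (scalar : ∀ z : ℂ, P (z • 1)) (add : ∀ A B, P A → P B → P (A + B))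
    (mul : ∀ A B, P A → P B → P (A * B)) (A : Module.End ℂ V) : P A := by
  have := h.1
  have htop : Algebra.adjoin ℂ {A : Module.End ℂ V | ∃ g ∈ K, A = (ρ g).toLinearMap} = ⊤ := by
    refine subalgebra_eq_top_of_irreducible _ fun S hS => h.2 S fun g hg v hv => ?_
    exact hS (ρ g).toLinearMap (Algebra.subset_adjoin ⟨g, hg, rfl⟩) v hv
  have hA : A ∈ Algebra.adjoin ℂ {A : Module.End ℂ V | ∃ g ∈ K, A = (ρ g).toLinearMap} :=
    htop ▸ Algebra.mem_top
  induction hA using Algebra.adjoin_induction with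
  | mem A hA => obtain ⟨g, hg, rfl⟩ := hA; exact mem g hg
  | algebraMap z => rw [Algebra.algebraMap_eq_smul_one]; exact scalar z
  | add A B _ _ hA hB => exact add A B hA hB
  | mul A B _ _ hA hB => exact mul A B hA hB

/-- The elements of `K` act by scalars. -/
def ScalarOn (ρ : TwistedRep α V) (K : Subgroup G) : Prop :=
  ∀ g ∈ K, ∃ z : ℂˣ, ∀ v, ρ g v = (z : ℂ) • v

theorem ScalarOn.mono {ρ : TwistedRep α V} {K L : Subgroup G} (h : ρ.ScalarOn L) (hKL : K ≤ L) :
    ρ.ScalarOn K := fun g hg => h g (hKL hg)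

theorem map_mul_eq (ρ : TwistedRep α V) (x y : G) (v : V) :
    ρ (x * y) v = ((α.1 x y)⁻¹ : ℂˣ).1 • ρ x (ρ y v) := by
  rw [ρ.map_mul', smul_smul, ← Units.val_mul, inv_mul_cancel, Units.val_one, one_smul]

theorem map_one_eq (ρ : TwistedRep α V) (v : V) : ρ 1 v = (α.1 1 1 : ℂ) • v := by
  apply (ρ 1).injective
  rw [ρ.map_mul', map_smul, mul_one]

theorem Inv.sup {ρ : TwistedRep α V} {K L : Subgroup G} {S : Submodule ℂ V} (hK : ρ.Inv K S)
    (hL : ρ.Inv L S) [L.Normal] : ρ.Inv (K ⊔ L) S := by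
  intro g hg v hv
  obtain ⟨x, hx, y, hy, rfl⟩ := Subgroup.mem_sup_of_normal_right.1 hg
  rw [map_mul_eq]
  exact S.smul_mem _ (hK x hx _ (hL y hy v hv))

theorem IrrOn.of_sup {ρ : TwistedRep α V} {K L : Subgroup G} [L.Normal] (h : ρ.IrrOn (K ⊔ L))
    (hL : ρ.ScalarOn L) : ρ.IrrOn K := by
  refine ⟨h.1, fun S hS => h.2 S (hS.sup fun g hg v hv => ?_)⟩
  obtain ⟨z, hz⟩ := hL g hg
  rw [hz]
  exact S.smul_mem _ hv

/-! ### Tensor products of projective modules -/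

section Tensor

variable {β γ : Z2 G} {W X : Type*} [AddCommGroup W] [Module ℂ W] [AddCommGroup X] [Module ℂ X]

theorem tensor_tmul (σ : TwistedRep β W) (τ : TwistedRep γ X) (g : G) (w : W) (x : X) :
    σ.tensor τ g (w ⊗ₜ x) = σ g w ⊗ₜ τ g x :=
  TensorProduct.congr_tmul _ _ _ _

/-- On K the action is σ ⊗ 1 up to scalars, so by Burnside an invariant subspace is stable under End
W ⊗ 1. It therefore has the form W ⊗ Y with Y invariant under H. -/
theorem irrOn_tensor [FiniteDimensional ℂ W] {σ : TwistedRep β W} {τ : TwistedRep γ X}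
    {K H : Subgroup G} (hKH : K ≤ H) (hσ : σ.IrrOn K) (hτ : τ.ScalarOn K) (hτ' : τ.IrrOn H) :
    (σ.tensor τ).IrrOn H := by
  have := hσ.1
  have := hτ'.1
  refine ⟨inferInstance, fun S hS => ?_⟩
  have hA : ∀ A : Module.End ℂ W, ∀ t ∈ S, A.rTensor X t ∈ S := by
    refine hσ.induction (fun g hg t ht => ?_) (fun z t ht => ?_) (fun A B hA hB t ht => ?_)
      fun A B hA hB t ht => ?_
    · obtain ⟨z, hz⟩ := hτ g hg
      have h : (σ g).toLinearMap.rTensor X t = (z⁻¹ : ℂˣ).1 • σ.tensor τ g t := by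
        clear ht
        induction t with
        | zero => simp
        | tmul w x =>
          rw [tensor_tmul, hz, TensorProduct.tmul_smul, smul_smul, ← Units.val_mul, inv_mul_cancel,
            Units.val_one, one_smul]
          rfl
        | add a b ha hb => rw [map_add, ha, hb, map_add, smul_add]
      rw [h]
      exact S.smul_mem _ (hS g (hKH hg) t ht)
    · rw [LinearMap.rTensor_smul, Module.End.one_eq_id, LinearMap.rTensor_id]
      exact S.smul_mem _ ht
    · rw [LinearMap.rTensor_add]
      exact S.add_mem (hA t ht) (hB t ht)
    · rw [LinearMap.rTensor_mul]
      exact hA _ (hB t ht)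
  -- Y consists of the x with W ⊗ x inside S; rank-one operators show that all contractions of
  -- elements of S lie in Y.
  let Y : Submodule ℂ X := ⨅ w, S.comap (TensorProduct.mk ℂ W X w)
  have hY : ∀ x, x ∈ Y ↔ ∀ w : W, w ⊗ₜ x ∈ S := fun x => by simp [Y]
  rcases hτ'.2 Y fun g hg x hx => (hY _).2 fun w => by
    have h := hS g hg _ ((hY x).1 hx ((σ g).symm w))
    rwa [tensor_tmul, LinearEquiv.apply_symm_apply] at h with h | h
  · refine Or.inl ((Submodule.eq_bot_iff S).2 fun t ht => eq_zero_of_contract_eq_zero fun φ => ?_)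
    rw [← Submodule.mem_bot ℂ, ← h, hY]
    intro w
    rw [← rTensor_smulRight]
    exact hA _ t ht
  · refine Or.inr (eq_top_iff.2 fun t _ => ?_)
    induction t with
    | zero => exact S.zero_mem
    | tmul w x => exact (hY x).1 (h ▸ Submodule.mem_top) w
    | add a b ha hb => exact S.add_mem (ha trivial) (hb trivial)

/-- The cocycle identity for the scalars follows from computing B x B y B t in two ways on a nonzero
vector. -/
theorem exists_of_projective [Nontrivial W] (B : G → W ≃ₗ[ℂ] W)
    (hB : ∀ g h, ∃ z : ℂˣ, ∀ w, B g (B h w) = (z : ℂ) • B (g * h) w) :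
    ∃ (β : Z2 G) (σ : TwistedRep β W), ∀ g, σ g = B g := by
  choose z hz using hB
  refine ⟨⟨z, fun x y t => ?_⟩, ⟨B, hz⟩, fun g => rfl⟩
  obtain ⟨w, hw⟩ := exists_ne (0 : W)
  have h1 : B x (B y (B t w)) = ((z x y * z (x * y) t : ℂˣ) : ℂ) • B (x * y * t) w := by
    rw [hz, hz, smul_smul, Units.val_mul]
  have h2 : B x (B y (B t w)) = ((z y t * z x (y * t) : ℂˣ) : ℂ) • B (x * y * t) w := by
    rw [hz y, map_smul, hz, smul_smul, Units.val_mul, mul_assoc]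
  exact Units.ext (smul_left_injective ℂ ((map_ne_zero_iff _ (B (x * y * t)).injective).2 hw)
    (h1.symm.trans h2))

/-- Arbitrary choices of B(g) and C(g) are multiplicative up to scalars, because the factors of B ⊗
C are unique up to scalars. -/
theorem exists_tensor_factors [Nontrivial W] [Nontrivial X] (ρ : TwistedRep α V)
    (f : V ≃ₗ[ℂ] W ⊗[ℂ] X)
    (h : ∀ g, ∃ (B : W ≃ₗ[ℂ] W) (C : X ≃ₗ[ℂ] X), ∀ v, f (ρ g v) = TensorProduct.congr B C (f v)) :
    ∃ (β γ : Z2 G) (σ : TwistedRep β W) (τ : TwistedRep γ X),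
      ∀ g v, f (ρ g v) = σ.tensor τ g (f v) := by
  choose B C hBC using h
  have key : ∀ x y w a, B x (B y w) ⊗ₜ[ℂ] C x (C y a) =
      B (x * y) w ⊗ₜ[ℂ] ((α.1 x y : ℂ) • C (x * y) a) := by
    intro x y w a
    have h := congrArg f (ρ.map_mul' x y (f.symm (w ⊗ₜ a)))
    rw [hBC, hBC, map_smul, hBC, LinearEquiv.apply_symm_apply] at h
    simpa using h
  have key' := fun x y => exists_scalar_of_tmul_eq ((B y).trans (B x)) (B (x * y)).toLinearMap
    ((C y).trans (C x)) ((α.1 x y : ℂ) • (C (x * y)).toLinearMap) (key x y)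
  obtain ⟨β, σ, hσ⟩ := exists_of_projective B fun x y => by
    obtain ⟨z, hz, -⟩ := key' x y
    exact ⟨z, hz⟩
  obtain ⟨γ, τ, hτ⟩ := exists_of_projective C fun x y => by
    obtain ⟨z, -, hz⟩ := key' x y
    refine ⟨z⁻¹ * α.1 x y, fun a => ?_⟩
    have h := congrArg (fun b => (z⁻¹ : ℂˣ).1 • b) (hz a)
    simp only [smul_smul, ← Units.val_mul, inv_mul_cancel, Units.val_one, one_smul,
      LinearMap.smul_apply] at h
    simpa using h
  refine ⟨β, γ, σ, τ, fun g v => ?_⟩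
  rw [hBC, ← hσ, ← hτ]
  rfl

theorem cocycle_eq_of_equiv [Nontrivial V] {U : Type*} [AddCommGroup U] [Module ℂ U]
    {ρ : TwistedRep α V} {σ : TwistedRep β U} (f : V ≃ₗ[ℂ] U)
    (h : ∀ g v, f (ρ g v) = σ g (f v)) : α = β := by
  refine Z2.ext fun x y => Units.ext ?_
  obtain ⟨v, hv⟩ := exists_ne (0 : V)
  have h1 := congrArg f (ρ.map_mul' x y v)
  rw [h, h, map_smul, h, σ.map_mul'] at h1
  refine (smul_left_injective ℂ ?_ h1).symm
  exact (map_ne_zero_iff _ (σ (x * y)).injective).2 ((map_ne_zero_iff f f.injective).2 hv)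

end Tensor

/-! ### Induced modules -/

section Induced

variable {J : Subgroup G} {U : Type*} [AddCommGroup U] [Module ℂ U]

/-- The element `j ∈ J` with `g = s j`, where `s` is the chosen representative of `g J`. -/
noncomputable def cosetPart (J : Subgroup G) (g : G) : J :=
  ⟨(g : G ⧸ J).out⁻¹ * g, QuotientGroup.eq.1 (Quotient.out_eq' _)⟩

theorem out_mul_cosetPart (J : Subgroup G) (g : G) : (g : G ⧸ J).out * cosetPart J g = g :=
  mul_inv_cancel_left _ _

theorem coe_mul_mem (g : G) (j : J) : ((g * j : G) : G ⧸ J) = g :=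
  (QuotientGroup.eq.2 (by simp)).symm

theorem cosetPart_mul (g : G) (j : J) : cosetPart J (g * j) = cosetPart J g * j := by
  refine Subtype.ext ?_
  change ((g * j : G) : G ⧸ J).out⁻¹ * (g * j) = (g : G ⧸ J).out⁻¹ * g * j
  rw [coe_mul_mem, mul_assoc]

theorem cosetPart_out (q : G ⧸ J) : cosetPart J q.out = 1 := by
  refine Subtype.ext ?_
  change ((q.out : G) : G ⧸ J).out⁻¹ * q.out = 1
  rw [QuotientGroup.out_eq', inv_mul_cancel]

/-- The coordinate of `ḡ ⊗ u` with respect to a transversal. -/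
noncomputable def indCoord (σ : TwistedRep (resZ2 J α) U) : (G →₀ U) →ₗ[ℂ] (G ⧸ J →₀ U) :=
  Finsupp.lsum ℂ fun g => ((α.1 (g : G ⧸ J).out (cosetPart J g))⁻¹ : ℂˣ).1 •
    Finsupp.lsingle (g : G ⧸ J) ∘ₗ (σ (cosetPart J g)).toLinearMap

theorem indCoord_single (σ : TwistedRep (resZ2 J α) U) (g : G) (u : U) :
    σ.indCoord (Finsupp.single g u) = Finsupp.single (g : G ⧸ J)
      (((α.1 (g : G ⧸ J).out (cosetPart J g))⁻¹ : ℂˣ).1 • σ (cosetPart J g) u) := by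
  simp [indCoord]

theorem indRel_le_ker_indCoord (σ : TwistedRep (resZ2 J α) U) :
    σ.indRel ≤ LinearMap.ker σ.indCoord := by
  refine Submodule.span_le.2 ?_
  rintro _ ⟨g, j, u, rfl⟩
  rw [SetLike.mem_coe, LinearMap.mem_ker, map_sub, indCoord_single, indCoord_single, sub_eq_zero,
    coe_mul_mem, cosetPart_mul, σ.map_mul', map_smul, smul_smul, smul_smul]
  congr 2
  rw [← Units.val_mul]
  change _ = ((_ : ℂˣ) : ℂ) * ((α.1 (cosetPart J g) j : ℂˣ) : ℂ)
  rw [← Units.val_mul, Units.val_inj]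
  have h := α.2 (g : G ⧸ J).out (cosetPart J g) j
  rw [out_mul_cosetPart] at h
  rw [inv_mul_eq_iff_eq_mul, mul_left_comm, eq_inv_mul_iff_mul_eq, h, mul_comm]
  rfl

/-- The induced module is the direct sum of the translates of `U`. -/
noncomputable def indEquiv (σ : TwistedRep (resZ2 J α) U) : σ.IndSpace ≃ₗ[ℂ] (G ⧸ J →₀ U) :=
  LinearEquiv.ofLinearMap (σ.indRel.liftQ σ.indCoord σ.indRel_le_ker_indCoord)
    (σ.indRel.mkQ ∘ₗ Finsupp.lsum ℂ fun q => Finsupp.lsingle q.out)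
    (by
      refine Finsupp.lhom_ext fun q u => ?_
      simp only [LinearMap.comp_apply, Finsupp.lsum_single, Finsupp.lsingle_apply,
        Submodule.mkQ_apply, Submodule.liftQ_apply, LinearMap.id_apply]
      rw [indCoord_single, cosetPart_out, QuotientGroup.out_eq']
      congr 1
      rw [map_one_eq, smul_smul]
      change ((((α.1 q.out 1)⁻¹ : ℂˣ) : ℂ) * ((α.1 1 1 : ℂˣ) : ℂ)) • u = u
      rw [cocycle_one_right, ← Units.val_mul, inv_mul_cancel, Units.val_one, one_smul])
    (by
      refine Submodule.linearMap_qext _ (Finsupp.lhom_ext fun g u => ?_)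
      simp only [LinearMap.comp_apply, Submodule.mkQ_apply, Submodule.liftQ_apply,
        LinearMap.id_apply]
      rw [indCoord_single, Finsupp.lsum_single, Finsupp.lsingle_apply, eq_comm,
        Submodule.Quotient.eq]
      refine Submodule.subset_span ⟨(g : G ⧸ J).out, cosetPart J g,
        ((α.1 (g : G ⧸ J).out (cosetPart J g))⁻¹ : ℂˣ).1 • u, ?_⟩
      rw [out_mul_cosetPart, map_smul, smul_smul, ← Units.val_mul, mul_inv_cancel, Units.val_one,
        one_smul])

theorem finrank_indSpace [Finite G] [FiniteDimensional ℂ U] (σ : TwistedRep (resZ2 J α) U) :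
    Module.finrank ℂ σ.IndSpace = J.index * Module.finrank ℂ U := by
  have := Fintype.ofFinite (G ⧸ J)
  rw [(σ.indEquiv.trans (Finsupp.linearEquivFunOnFinite ℂ U (G ⧸ J))).finrank_eq,
    Module.finrank_pi_fintype, Finset.sum_const, Finset.card_univ, Subgroup.index,
    Nat.card_eq_fintype_card, smul_eq_mul]

theorem finiteDimensional_indSpace [Finite G] [FiniteDimensional ℂ U]
    (σ : TwistedRep (resZ2 J α) U) : FiniteDimensional ℂ σ.IndSpace :=
  Module.Finite.equiv σ.indEquiv.symm

/-- The map `ḡ ⊗ u ↦ g u` from the induced module. -/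
noncomputable def indLift (ρ : TwistedRep α V) (σ : TwistedRep (resZ2 J α) U) (i : U →ₗ[ℂ] V)
    (hi : ∀ j u, i (σ j u) = ρ j (i u)) : σ.IndSpace →ₗ[ℂ] V :=
  σ.indRel.liftQ (Finsupp.lsum ℂ fun g => (ρ g).toLinearMap ∘ₗ i) (by
    refine Submodule.span_le.2 ?_
    rintro _ ⟨g, j, u, rfl⟩
    rw [SetLike.mem_coe, LinearMap.mem_ker, map_sub, Finsupp.lsum_single, Finsupp.lsum_single]
    simp [hi, ρ.map_mul'])

theorem indLift_ind (ρ : TwistedRep α V) (σ : TwistedRep (resZ2 J α) U) (i : U →ₗ[ℂ] V)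
    (hi : ∀ j u, i (σ j u) = ρ j (i u)) (x : G) (t : σ.IndSpace) :
    indLift ρ σ i hi (σ.ind x t) = ρ x (indLift ρ σ i hi t) := by
  obtain ⟨f, rfl⟩ := Submodule.Quotient.mk_surjective _ t
  change (Finsupp.lsum ℂ fun g => (ρ g).toLinearMap ∘ₗ i) (preAct α U x f) =
    ρ x ((Finsupp.lsum ℂ fun g => (ρ g).toLinearMap ∘ₗ i) f)
  induction f using Finsupp.induction_linear with
  | zero => simp
  | add a b ha hb => simp only [map_add, ha, hb]
  | single g u =>
    rw [preAct_single, Finsupp.lsum_single, Finsupp.lsum_single]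
    simp [ρ.map_mul']

theorem indLift_surjective {ρ : TwistedRep α V} (hρ : ρ.IsIrreducible)
    (σ : TwistedRep (resZ2 J α) U) (i : U →ₗ[ℂ] V) (hi : ∀ j u, i (σ j u) = ρ j (i u))
    (h0 : i ≠ 0) : Function.Surjective (indLift ρ σ i hi) := by
  rw [← LinearMap.range_eq_top]
  refine (hρ.2 _ ?_).resolve_left fun h => h0 ?_
  · rintro g _ ⟨t, rfl⟩
    exact ⟨σ.ind g t, indLift_ind ρ σ i hi g t⟩
  · rw [LinearMap.range_eq_bot] at h
    ext u
    have h1 : indLift ρ σ i hi (Submodule.Quotient.mk (Finsupp.single 1 u)) = ρ 1 (i u) := by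
      change (Finsupp.lsum ℂ fun g => (ρ g).toLinearMap ∘ₗ i) (Finsupp.single 1 u) = _
      rw [Finsupp.lsum_single]
      rfl
    rw [h] at h1
    exact (map_eq_zero_iff _ (ρ 1).injective).1 h1.symm

theorem finrank_le_index_mul [Finite G] [FiniteDimensional ℂ U] {ρ : TwistedRep α V}
    (hρ : ρ.IsIrreducible) (σ : TwistedRep (resZ2 J α) U) (i : U →ₗ[ℂ] V)
    (hi : ∀ j u, i (σ j u) = ρ j (i u)) (h0 : i ≠ 0) :
    Module.finrank ℂ V ≤ J.index * Module.finrank ℂ U := by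
  have := σ.finiteDimensional_indSpace
  rw [← σ.finrank_indSpace]
  exact LinearMap.finrank_le_finrank_of_surjective (indLift_surjective hρ σ i hi h0)

/-- The map ḡ ⊗ u ↦ g u is onto since V is irreducible, and bijective by the equality of dimensions.
-/
theorem isomorphic_ind [Finite G] [FiniteDimensional ℂ V] [FiniteDimensional ℂ U]
    {ρ : TwistedRep α V} (hρ : ρ.IsIrreducible) (σ : TwistedRep (resZ2 J α) U) (i : U →ₗ[ℂ] V)
    (hi : ∀ j u, i (σ j u) = ρ j (i u)) (h0 : i ≠ 0)
    (hd : Module.finrank ℂ V = J.index * Module.finrank ℂ U) : ρ.Isomorphic σ.ind := by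
  have := σ.finiteDimensional_indSpace
  have hs := indLift_surjective hρ σ i hi h0
  have hi' := (LinearMap.injective_iff_surjective_of_finrank_eq_finrank
    (σ.finrank_indSpace.trans hd.symm)).2 hs
  refine ⟨(LinearEquiv.ofBijective _ ⟨hi', hs⟩).symm, fun g v => ?_⟩
  rw [LinearEquiv.symm_apply_eq]
  change _ = indLift ρ σ i hi (σ.ind g _)
  rw [indLift_ind]
  congr 1
  exact ((LinearEquiv.ofBijective _ ⟨hi', hs⟩).apply_symm_apply v).symm

theorem IsInducedFrom.finrank_eq [Finite G] [FiniteDimensional ℂ U] {ρ : TwistedRep α V}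
    {β : Z2 J} {σ : TwistedRep β U} (h : ρ.IsInducedFrom J σ) :
    Module.finrank ℂ V = J.index * Module.finrank ℂ U := by
  obtain ⟨τ, -, f, -⟩ := h
  rw [f.finrank_eq, finrank_indSpace]

/-- The restriction to `J` of `ρ` on an invariant subspace. -/
noncomputable def subrep [FiniteDimensional ℂ V] (ρ : TwistedRep α V) (S : Submodule ℂ V)
    (hS : ρ.Inv J S) : TwistedRep (resZ2 J α) S where
  toFun j := LinearEquiv.ofInjectiveEndo ((ρ j).toLinearMap.restrict (hS j j.2)) (by
    intro x y h
    exact Subtype.ext ((ρ j).injective (congrArg Subtype.val h)))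
  map_mul' x y v := Subtype.ext (ρ.map_mul' x y v)

end Induced

end TwistedRep

namespace TwistedRep

variable {G : Type*} [Group G] {α : Z2 G} {V : Type*} [AddCommGroup V] [Module ℂ V]

/-! ### Degrees divide the order of the group -/

theorem IsIrreducible.exists_scalar [FiniteDimensional ℂ V] {ρ : TwistedRep α V}
    (hρ : ρ.IsIrreducible) (T : Module.End ℂ V) (hT : ∀ g v, T (ρ g v) = ρ g (T v)) :
    ∃ z : ℂ, ∀ v, T v = z • v := by
  have := hρ.1
  obtain ⟨z, hz⟩ := Module.End.exists_eigenvalue T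
  refine ⟨z, fun v => ?_⟩
  have h := (hρ.2 (Module.End.eigenspace T z) fun g w hw => ?_).resolve_left hz
  · exact Module.End.mem_eigenspace_iff.1 (h ▸ Submodule.mem_top)
  · rw [Module.End.mem_eigenspace_iff] at hw ⊢
    rw [hT, hw, map_smul]

theorem conj_conj (ρ : TwistedRep α V) (g h : G) (A : Module.End ℂ V) :
    (ρ g).conj ((ρ h).conj A) = (ρ (g * h)).conj A := by
  refine LinearMap.ext fun v => ?_
  obtain ⟨u, rfl⟩ := ((ρ h).trans (ρ g)).surjective v
  have h1 : (ρ (g * h)).symm (ρ g (ρ h u)) = (α.1 g h : ℂ) • u := by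
    rw [ρ.map_mul', map_smul, LinearEquiv.symm_apply_apply]
  simp only [LinearEquiv.conj_apply, LinearMap.comp_apply, LinearEquiv.coe_coe,
    LinearEquiv.trans_apply, LinearEquiv.symm_apply_apply, h1]
  rw [ρ.map_mul', map_smul, map_smul]

/-- The sum of the conjugates of A commutes with G, so it is a scalar by Schur's lemma; the trace
gives its value. -/
theorem IsIrreducible.sum_conj_eq [Fintype G] [FiniteDimensional ℂ V] {ρ : TwistedRep α V}
    (hρ : ρ.IsIrreducible) (A : Module.End ℂ V) (v : V) :
    ∑ g, ρ g (A ((ρ g).symm v)) =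
      ((Fintype.card G : ℂ) / Module.finrank ℂ V * LinearMap.trace ℂ V A) • v := by
  have := hρ.1
  obtain ⟨z, hz⟩ := hρ.exists_scalar (∑ g, (ρ g).conj A) fun h v => by
    have key : (ρ h).conj (∑ g, (ρ g).conj A) = ∑ g, (ρ g).conj A := by
      rw [map_sum]
      simp_rw [conj_conj]
      exact Fintype.sum_equiv (Equiv.mulLeft h) _ _ fun _ => rfl
    conv_lhs => rw [← key]
    simp [LinearEquiv.conj_apply]
  have htr := congrArg (LinearMap.trace ℂ V)
    (show ∑ g, (ρ g).conj A = z • LinearMap.id from LinearMap.ext hz)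
  simp only [map_sum, LinearMap.trace_conj', map_smul, LinearMap.trace_id, Finset.sum_const,
    Finset.card_univ, nsmul_eq_mul, smul_eq_mul] at htr
  have hd : (Module.finrank ℂ V : ℂ) ≠ 0 := Nat.cast_ne_zero.2 Module.finrank_pos.ne'
  have h1 := hz v
  rw [LinearMap.sum_apply] at h1
  rw [div_mul_eq_mul_div, htr, mul_div_cancel_right₀ _ hd, ← h1]
  rfl

/-- The operators of determinant one that are proportional to some `ρ g`. -/
def detOne (ρ : TwistedRep α V) : Submonoid (Module.End ℂ V) where
  carrier := {A | LinearMap.det A = 1 ∧ ∃ (g : G) (c : ℂ), A = c • (ρ g).toLinearMap}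
  one_mem' := by
    refine ⟨map_one _, 1, ((α.1 1 1)⁻¹ : ℂˣ), LinearMap.ext fun v => ?_⟩
    change v = ((α.1 1 1)⁻¹ : ℂˣ).1 • ρ 1 v
    rw [map_one_eq, smul_smul, ← Units.val_mul, inv_mul_cancel, Units.val_one, one_smul]
  mul_mem' := by
    rintro A B ⟨hA, g, c, rfl⟩ ⟨hB, h, d, rfl⟩
    refine ⟨by rw [map_mul, hA, hB, one_mul], g * h, c * d * α.1 g h, ?_⟩
    rw [smul_mul_smul_comm, mul_smul (c * d), ← ρ.comp_eq]
    rfl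

/-- For each g the multiplier c satisfies c^(dim V) = (det ρ(g))⁻¹, leaving finitely many choices.
-/
theorem finite_detOne [Finite G] [FiniteDimensional ℂ V] [Nontrivial V] (ρ : TwistedRep α V) :
    (ρ.detOne : Set (Module.End ℂ V)).Finite := by
  have hd : 0 < Module.finrank ℂ V := Module.finrank_pos
  refine (Set.finite_iUnion fun g : G => Set.Finite.image (fun c : ℂ => c • (ρ g).toLinearMap)
    (s := {c | c ∈ Polynomial.nthRoots (Module.finrank ℂ V)
      (LinearMap.det (ρ g).toLinearMap)⁻¹}) (Multiset.finite_toSet _)).subset ?_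
  rintro A ⟨hA, g, c, rfl⟩
  refine Set.mem_iUnion.2 ⟨g, c, (Polynomial.mem_nthRoots hd).2 ?_, rfl⟩
  rw [LinearMap.det_smul] at hA
  exact eq_inv_of_mul_eq_one_left hA

/-- Rescaling ρ(g) does not change ρ(g)⁻¹ ⊗ ρ(g), so ρ(g) may be normalized to determinant one. -/
theorem exists_detOne [FiniteDimensional ℂ V] [Nontrivial V] (ρ : TwistedRep α V) (g : G) :
    ∃ A ∈ ρ.detOne, ∃ B ∈ ρ.detOne,
      TensorProduct.map (ρ g).symm.toLinearMap (ρ g).toLinearMap = TensorProduct.map A B := by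
  have hd : 0 < Module.finrank ℂ V := Module.finrank_pos
  have hdet : LinearMap.det (ρ g).toLinearMap ≠ 0 := (ρ g).isUnit_det'.ne_zero
  obtain ⟨c, hc⟩ := IsAlgClosed.exists_pow_nat_eq (LinearMap.det (ρ g).toLinearMap)⁻¹ hd
  have hc0 : c ≠ 0 := by
    rintro rfl
    rw [zero_pow hd.ne'] at hc
    exact inv_ne_zero hdet hc.symm
  have hB : LinearMap.det (c • (ρ g).toLinearMap) = 1 := by
    rw [LinearMap.det_smul, hc, inv_mul_cancel₀ hdet]
  refine ⟨c⁻¹ • (ρ g).symm.toLinearMap, ⟨?_, g⁻¹, ?_⟩, c • (ρ g).toLinearMap, ⟨hB, g, c, rfl⟩, ?_⟩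
  · have h : (c⁻¹ • (ρ g).symm.toLinearMap) * (c • (ρ g).toLinearMap) = 1 := by
      ext v
      simp [hc0]
    have h' := congrArg LinearMap.det h
    rwa [map_mul, hB, mul_one, map_one] at h'
  · refine ⟨c⁻¹ * ((α.1 g g⁻¹ * α.1 1 1)⁻¹ : ℂˣ), LinearMap.ext fun v => ?_⟩
    rw [LinearMap.smul_apply, LinearMap.smul_apply, mul_smul]
    congr 1
    apply (ρ g).injective
    rw [map_smul]
    simp only [LinearEquiv.coe_coe, LinearEquiv.apply_symm_apply]
    rw [ρ.map_mul', mul_inv_cancel, map_one_eq, smul_smul, smul_smul, ← Units.val_mul,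
      ← Units.val_mul, mul_assoc, inv_mul_cancel, Units.val_one, one_smul]
  · rw [TensorProduct.map_smul_left, TensorProduct.map_smul_right, smul_smul,
      inv_mul_cancel₀ hc0, one_smul]

/-- The operator P = ∑ ρ(g)⁻¹ ⊗ ρ(g) is |G|/dim V times the swap of V ⊗ V, so P² is the scalar
(|G|/dim V)². P lies in the ring spanned over ℤ by a finite monoid of operators, so P is integral,
and hence so is the rational number |G|/dim V. -/
theorem IsIrreducible.finrank_dvd_card [Finite G] [FiniteDimensional ℂ V] {ρ : TwistedRep α V}
    (hρ : ρ.IsIrreducible) : Module.finrank ℂ V ∣ Nat.card G := by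
  have := hρ.1
  have := Fintype.ofFinite G
  have hd : (Module.finrank ℂ V : ℂ) ≠ 0 := Nat.cast_ne_zero.2 Module.finrank_pos.ne'
  obtain ⟨c, hc⟩ : ∃ c : ℚ, c = (Fintype.card G : ℚ) / Module.finrank ℂ V := ⟨_, rfl⟩
  have hc' : (c : ℂ) = (Fintype.card G : ℂ) / Module.finrank ℂ V := by rw [hc]; push_cast; rfl
  set P : Module.End ℂ (V ⊗[ℂ] V) :=
    ∑ g, TensorProduct.map (ρ g).symm.toLinearMap (ρ g).toLinearMap with hP
  have hPt : ∀ u w : V, P (u ⊗ₜ w) = (c : ℂ) • w ⊗ₜ[ℂ] u := by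
    intro u w
    rw [← sub_eq_zero]
    refine eq_zero_of_contract_eq_zero fun φ => ?_
    have h1 := hρ.sum_conj_eq (φ.smulRight w) u
    rw [LinearMap.trace_smulRight, ← hc'] at h1
    rw [map_sub, map_smul, contract_tmul, sub_eq_zero, smul_smul, ← h1, hP, LinearMap.sum_apply,
      map_sum]
    refine Finset.sum_congr rfl fun g _ => ?_
    simp
  have hPP : P * P = algebraMap ℂ _ ((c : ℂ) ^ 2) := by
    refine TensorProduct.ext' fun u w => ?_
    rw [Module.End.mul_apply, hPt, map_smul, hPt, Algebra.algebraMap_eq_smul_one, smul_smul, sq]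
    rfl
  let M : Submonoid (Module.End ℂ (V ⊗[ℂ] V)) :=
    { carrier := Set.image2 TensorProduct.map ρ.detOne ρ.detOne
      one_mem' := ⟨1, one_mem _, 1, one_mem _, TensorProduct.map_one⟩
      mul_mem' := by
        rintro _ _ ⟨A, hA, B, hB, rfl⟩ ⟨A', hA', B', hB', rfl⟩
        exact ⟨A * A', mul_mem hA hA', B * B', mul_mem hB hB', TensorProduct.map_mul _ _ _ _⟩ }
  have hM : (M : Set (Module.End ℂ (V ⊗[ℂ] V))).Finite := ρ.finite_detOne.image2 _ ρ.finite_detOne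
  have hint : IsIntegral ℤ P := by
    refine IsIntegral.of_mem_of_fg (Algebra.adjoin ℤ (M : Set (Module.End ℂ (V ⊗[ℂ] V)))) ?_ P ?_
    · rw [Algebra.adjoin_eq_span, Submonoid.closure_eq]
      exact Submodule.fg_span hM
    · refine sum_mem fun g _ => Algebra.subset_adjoin ?_
      obtain ⟨A, hA, B, hB, h⟩ := ρ.exists_detOne g
      exact ⟨A, hA, B, hB, h.symm⟩
  have hint2 := hint.pow 2
  rw [sq, hPP, isIntegral_algebraMap_iff (algebraMap ℂ (Module.End ℂ (V ⊗[ℂ] V))).injective] at hint2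
  have hintc : IsIntegral ℤ (algebraMap ℚ ℂ c) := hint2.of_pow two_pos
  rw [isIntegral_algebraMap_iff (algebraMap ℚ ℂ).injective] at hintc
  obtain ⟨n, hn⟩ := IsIntegrallyClosed.isIntegral_iff.1 hintc
  have hn' : (n : ℚ) = (Fintype.card G : ℚ) / Module.finrank ℂ V := hn.trans hc
  rw [eq_div_iff (by exact_mod_cast hd)] at hn'
  rw [Nat.card_eq_fintype_card, ← Int.natCast_dvd_natCast]
  exact ⟨n, by rw [mul_comm]; exact_mod_cast hn'.symm⟩

theorem IrrOn.isPiNumber_finrank [Finite G] [FiniteDimensional ℂ V] {ρ : TwistedRep α V}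
    {π : Set ℕ} {H : Subgroup G} (h : ρ.IrrOn H) (hH : IsPiNumber π (Nat.card H)) :
    IsPiNumber π (Module.finrank ℂ V) :=
  hH.of_dvd (isIrreducible_res.2 h).finrank_dvd_card

end TwistedRep

/-! ### Isotypic components under semilinear automorphisms -/

/-- Conjugating an isomorphism m ≅ S by e makes the two twists cancel, so e(m) ≅ e(S) is again
linear. -/
theorem map_isotypicComponent {R V : Type*} [Ring R] [AddCommGroup V] [Module R V]
    {σ σ' : R →+* R} [RingHomInvPair σ σ'] [RingHomInvPair σ' σ] (e : V ≃ₛₗ[σ] V)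
    (S : Submodule R V) :
    (isotypicComponent R V S).map e.toLinearMap =
      isotypicComponent R V (S.map e.toLinearMap) := by
  have key : ∀ m : Submodule R V, Nonempty (m.map e.toLinearMap ≃ₗ[R] S.map e.toLinearMap) ↔
      Nonempty (m ≃ₗ[R] S) := fun m =>
    ⟨fun ⟨f⟩ => ⟨((e.submoduleMap m).trans f).trans (e.submoduleMap S).symm⟩,
      fun ⟨f⟩ => ⟨((e.submoduleMap m).symm.trans f).trans (e.submoduleMap S)⟩⟩
  change Submodule.orderIsoMapComap e (sSup _) = sSup _
  rw [OrderIso.map_sSup_eq_sSup_symm_preimage]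
  congr 1
  ext m
  obtain ⟨m, rfl⟩ := (Submodule.orderIsoMapComap e).surjective m
  rw [Set.mem_preimage, OrderIso.symm_apply_apply]
  exact (key m).symm

namespace TwistedRep

variable {G : Type*} [Group G] {α : Z2 G} {V : Type v} [AddCommGroup V] [Module ℂ V]

/-- The operator algebra of the normal subgroup `M`. -/
def opAlgebra (ρ : TwistedRep α V) (M : Subgroup G) : Subalgebra ℂ (Module.End ℂ V) :=
  Algebra.adjoin ℂ {A | ∃ m ∈ M, A = (ρ m).toLinearMap}

theorem mem_opAlgebra (ρ : TwistedRep α V) {M : Subgroup G} {m : G} (hm : m ∈ M) :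
    (ρ m).toLinearMap ∈ ρ.opAlgebra M :=
  Algebra.subset_adjoin ⟨m, hm, rfl⟩

theorem conj_mem_opAlgebra (ρ : TwistedRep α V) (M : Subgroup G) [M.Normal] (g : G)
    {A : Module.End ℂ V} (hA : A ∈ ρ.opAlgebra M) : (ρ g).conj A ∈ ρ.opAlgebra M := by
  induction hA using Algebra.adjoin_induction with
  | mem A hA =>
    obtain ⟨m, hm, rfl⟩ := hA
    have h : (ρ g).conj (ρ m).toLinearMap =
        (α.1 g m * (α.1 (g * m * g⁻¹) g)⁻¹ : ℂˣ).1 • (ρ (g * m * g⁻¹)).toLinearMap := by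
      refine LinearMap.ext fun v => ?_
      obtain ⟨u, rfl⟩ := (ρ g).surjective v
      simp only [LinearEquiv.conj_apply, LinearMap.comp_apply, LinearEquiv.coe_coe,
        LinearEquiv.symm_apply_apply, LinearMap.smul_apply]
      rw [ρ.map_mul', ρ.map_mul', smul_smul, ← Units.val_mul, inv_mul_cancel_right,
        inv_mul_cancel_right]
    rw [h]
    exact Subalgebra.smul_mem _ 
      (ρ.mem_opAlgebra (Subgroup.Normal.conj_mem inferInstance m hm g)) _
  | algebraMap z =>
    rw [Algebra.algebraMap_eq_smul_one, map_smul, Module.End.one_eq_id, LinearEquiv.conj_id]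
    exact Subalgebra.smul_mem _ (one_mem _) _
  | add A B _ _ hA hB => rw [map_add]; exact add_mem hA hB
  | mul A B _ _ hA hB =>
    rw [Module.End.mul_eq_comp, LinearEquiv.conj_comp]
    exact mul_mem hA hB

theorem conj_symm_eq (ρ : TwistedRep α V) (g : G) (A : Module.End ℂ V) :
    (ρ g).symm.conj A = (ρ g⁻¹).conj A := by
  apply (ρ g).conj.injective
  rw [conj_conj, mul_inv_cancel]
  refine LinearMap.ext fun v => ?_
  obtain ⟨u, rfl⟩ := (ρ 1).surjective v
  have h : (ρ g).conj ((ρ g).symm.conj A) = A := (ρ g).conj.apply_symm_apply A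
  rw [h]
  simp only [LinearEquiv.conj_apply, LinearMap.comp_apply, LinearEquiv.coe_coe,
    LinearEquiv.symm_apply_apply]
  simp only [map_one_eq, map_smul]

/-- Conjugation by `ρ g` on the operator algebra of a normal subgroup. -/
def conjEquiv (ρ : TwistedRep α V) (M : Subgroup G) [M.Normal] (g : G) :
    ρ.opAlgebra M ≃+* ρ.opAlgebra M where
  toFun A := ⟨(ρ g).conj A.1, ρ.conj_mem_opAlgebra M g A.2⟩
  invFun A := ⟨(ρ g).symm.conj A.1, by
    rw [conj_symm_eq]; exact ρ.conj_mem_opAlgebra M g⁻¹ A.2⟩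
  left_inv A := Subtype.ext ((ρ g).conj.symm_apply_apply A.1)
  right_inv A := Subtype.ext ((ρ g).conj.apply_symm_apply A.1)
  map_mul' A B := Subtype.ext (LinearEquiv.conj_comp (ρ g) B.1 A.1)
  map_add' A B := Subtype.ext (map_add (ρ g).conj A.1 B.1)

/-- ρ(g) is semilinear over its own conjugation action on the operator algebra of M, so it permutes
isotypic components. -/
theorem exists_isotypicComponent_translate (ρ : TwistedRep α V) (M : Subgroup G) [M.Normal] (g : G)
    (S : Submodule (ρ.opAlgebra M) V) (hS : IsSimpleModule (ρ.opAlgebra M) S) :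
    ∃ c ∈ isotypicComponents (ρ.opAlgebra M) V,
      c.restrictScalars ℂ = ((isotypicComponent (ρ.opAlgebra M) V S).restrictScalars ℂ).map
        (ρ g).toLinearMap := by
  let φ := ρ.conjEquiv M g
  have := RingHomInvPair.of_ringEquiv φ
  have : RingHomInvPair (φ.symm : ρ.opAlgebra M →+* ρ.opAlgebra M) (φ : _ →+* _) :=
    RingHomInvPair.symm _ _
  let e : V ≃ₛₗ[(φ : ρ.opAlgebra M →+* ρ.opAlgebra M)] V :=
    { (ρ g) with
      map_smul' := fun A v => by
        change ρ g (A.1 v) = (ρ g).conj A.1 (ρ g v)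
        simp [LinearEquiv.conj_apply] }
  refine ⟨(isotypicComponent (ρ.opAlgebra M) V S).map e.toLinearMap, ?_, ?_⟩
  · rw [map_isotypicComponent]
    refine ⟨_, ?_, rfl⟩
    rw [isSimpleModule_iff_isAtom] at hS ⊢
    exact (Submodule.orderIsoMapComap e).isAtom_iff _ |>.2 hS
  · ext v
    simp only [Submodule.restrictScalars_mem, Submodule.mem_map]
    rfl

end TwistedRep

namespace TwistedRep

variable {G : Type*} [Group G] {α : Z2 G} {V : Type v} [AddCommGroup V] [Module ℂ V]

/-! ### Clifford theory for primitive modules -/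

/-- The module is not induced from a proper subgroup. -/
def Primitive (ρ : TwistedRep α V) : Prop :=
  ∀ (J : Subgroup G) (S : Submodule ℂ V), ρ.Inv J S →
    Module.finrank ℂ V = J.index * Module.finrank ℂ S → J = ⊤

/-- The action of the group on subspaces. -/
@[reducible]
def subspaceAction (ρ : TwistedRep α V) : MulAction G (Submodule ℂ V) where
  smul g S := S.map (ρ g).toLinearMap
  one_smul S := by
    change S.map (ρ 1).toLinearMap = S
    refine le_antisymm (Submodule.map_le_iff_le_comap.2 fun v hv => ?_) fun v hv => ?_
    · change ρ 1 v ∈ S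
      rw [map_one_eq]
      exact S.smul_mem _ hv
    · refine ⟨((α.1 1 1)⁻¹ : ℂˣ).1 • v, S.smul_mem _ hv, ?_⟩
      change ρ 1 _ = v
      rw [map_one_eq, smul_smul, ← Units.val_mul, mul_inv_cancel, Units.val_one, one_smul]
  mul_smul g h S := by
    change S.map (ρ (g * h)).toLinearMap = (S.map (ρ h).toLinearMap).map (ρ g).toLinearMap
    rw [← Submodule.map_comp, ρ.comp_eq, Submodule.map_smul _ _ _ (Units.ne_zero _)]

/-- Clifford's theorem: the translates of an isotypic component are independent, of equal dimension,
and span V by irreducibility. J is the stabilizer of the component. -/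
theorem finrank_eq_index_mul_isotypicComponent [Finite G] [FiniteDimensional ℂ V]
    {ρ : TwistedRep α V} (hρ : ρ.IsIrreducible) (M : Subgroup G) [M.Normal]
    (S : Submodule (ρ.opAlgebra M) V) (hS : IsSimpleModule (ρ.opAlgebra M) S) :
    ∃ J : Subgroup G, ρ.Inv J ((isotypicComponent (ρ.opAlgebra M) V S).restrictScalars ℂ) ∧
      Module.finrank ℂ V = J.index *
        Module.finrank ℂ ((isotypicComponent (ρ.opAlgebra M) V S).restrictScalars ℂ) := by
  classical
  set C := (isotypicComponent (ρ.opAlgebra M) V S).restrictScalars ℂ with hC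
  let := ρ.subspaceAction
  have hsmul : ∀ (g : G) (T : Submodule ℂ V), g • T = T.map (ρ g).toLinearMap := fun _ _ => rfl
  have hmem : ∀ (g : G) (T : Submodule ℂ V) v, v ∈ T → ρ g v ∈ g • T := fun g T v hv => ⟨v, hv, rfl⟩
  let J := MulAction.stabilizer G C
  let F : G ⧸ J → Submodule ℂ V := MulAction.ofQuotientStabilizer G C
  have hF : ∀ q, ∃ c ∈ isotypicComponents (ρ.opAlgebra M) V, c.restrictScalars ℂ = F q := by
    intro q
    obtain ⟨g, rfl⟩ := QuotientGroup.mk_surjective q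
    exact ρ.exists_isotypicComponent_translate M g S hS
  choose N hN hNF using hF
  have hNinj : Function.Injective N := fun p q h =>
    MulAction.injective_ofQuotientStabilizer G C (by
      change F p = F q
      rw [← hNF, ← hNF, h])
  have hind : iSupIndep N :=
    ((sSupIndep_iff _).1 (sSupIndep_isotypicComponents (ρ.opAlgebra M) V)).comp
      (f := fun q => (⟨N q, hN q⟩ : isotypicComponents (ρ.opAlgebra M) V))
      fun p q h => hNinj (congrArg Subtype.val h)
  have hmemF : ∀ q v, v ∈ N q ↔ v ∈ F q := fun q v => by
    rw [← hNF, Submodule.restrictScalars_mem]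
  have htop : ⨆ q, N q = ⊤ := by
    have h := hρ.2 ((⨆ q, N q).restrictScalars ℂ) fun g v hv => by
      rw [Submodule.restrictScalars_mem] at hv ⊢
      induction hv using Submodule.iSup_induction' with
      | mem q v hv =>
        refine Submodule.mem_iSup_of_mem (g • q) ((hmemF _ _).2 ?_)
        have h1 : F (g • q) = g • F q := MulAction.ofQuotientStabilizer_smul G C g q
        rw [h1]
        exact hmem g _ v ((hmemF q v).1 hv)
      | zero => rw [map_zero]; exact zero_mem _
      | add x y _ _ hx hy => rw [map_add]; exact add_mem hx hy
    rw [Submodule.restrictScalars_eq_top_iff, Submodule.restrictScalars_eq_bot_iff] at h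
    refine h.resolve_left fun h0 => ?_
    have h1 := bot_lt_isotypicComponents (hN (1 : G))
    exact h1.not_ge (h0 ▸ le_iSup N ((1 : G) : G ⧸ J))
  have hfin : ∀ q, Module.finrank ℂ (N q) = Module.finrank ℂ C := by
    intro q
    obtain ⟨g, rfl⟩ := QuotientGroup.mk_surjective q
    have h1 : (N g).restrictScalars ℂ = C.map (ρ g).toLinearMap := hNF g
    change Module.finrank ℂ ((N g).restrictScalars ℂ) = _
    rw [h1]
    exact LinearEquiv.finrank_map_eq (ρ g) C
  refine ⟨J, fun g hg v hv => ?_, ?_⟩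
  · have h := hmem g C v hv
    rwa [MulAction.mem_stabilizer_iff.1 hg] at h
  · have := Fintype.ofFinite (G ⧸ J)
    have e : (Π₀ q, N q) ≃ₗ[ℂ] V := (hind.linearEquiv htop).restrictScalars ℂ
    have e' : (Π₀ q, N q) ≃ₗ[ℂ] (∀ q, N q) := DFinsupp.linearEquivFunOnFintype
    have hfd : ∀ q, FiniteDimensional ℂ (N q) := fun q =>
      inferInstanceAs (FiniteDimensional ℂ ((N q).restrictScalars ℂ))
    rw [← e.finrank_eq, e'.finrank_eq, Module.finrank_pi_fintype, Finset.sum_congr rfl fun q _ =>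
      hfin q, Finset.sum_const, Finset.card_univ, Subgroup.index, Nat.card_eq_fintype_card,
      smul_eq_mul]

/-- Primitivity forces the stabilizer of an isotypic component to be G, so that component is all of
V. -/
theorem Primitive.exists_linearEquiv_fun [Finite G] [FiniteDimensional ℂ V] {ρ : TwistedRep α V}
    (hp : ρ.Primitive) (hρ : ρ.IsIrreducible) (M : Subgroup G) [M.Normal] :
    ∃ (S : Submodule (ρ.opAlgebra M) V) (n : ℕ), IsSimpleModule (ρ.opAlgebra M) S ∧
      Nonempty (V ≃ₗ[ρ.opAlgebra M] (Fin n → S)) := by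
  have := hρ.1
  have : IsArtinian (ρ.opAlgebra M) V := isArtinian_of_tower ℂ inferInstance
  obtain ⟨S, hS⟩ := IsAtomic.exists_atom (Submodule (ρ.opAlgebra M) V)
  rw [← isSimpleModule_iff_isAtom] at hS
  obtain ⟨J, hJ, hd⟩ := finrank_eq_index_mul_isotypicComponent hρ M S hS
  have htop : isotypicComponent (ρ.opAlgebra M) V S = ⊤ := by
    obtain rfl := hp J _ hJ hd
    have h := hρ.2 _ fun g v hv => hJ g trivial v hv
    rw [Submodule.restrictScalars_eq_top_iff, Submodule.restrictScalars_eq_bot_iff] at h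
    exact h.resolve_left (bot_lt_isotypicComponent S).ne'
  have hss : IsSemisimpleModule (ρ.opAlgebra M) (isotypicComponent (ρ.opAlgebra M) V S) :=
    inferInstance
  rw [htop] at hss
  have : IsSemisimpleModule (ρ.opAlgebra M) V := 
    IsSemisimpleModule.congr (M := (⊤ : Submodule (ρ.opAlgebra M) V)) Submodule.topEquiv.symm
  have : Module.Finite (ρ.opAlgebra M) V := Module.Finite.of_restrictScalars_finite ℂ _ _
  obtain ⟨n, e⟩ := (IsIsotypicOfType.of_isotypicComponent_eq_top htop).linearEquiv_fun
  exact ⟨S, n, hS, e⟩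

end TwistedRep

namespace TwistedRep

variable {G : Type*} [Group G] {α : Z2 G} {V : Type v} [AddCommGroup V] [Module ℂ V]

/-! ### Tensor factorization over a normal subgroup -/

/-- A vector space of functions valued in `W` as a tensor product. -/
noncomputable def funEquivTensor (W : Type*) [AddCommGroup W] [Module ℂ W] (n : ℕ) :
    (Fin n → W) ≃ₗ[ℂ] W ⊗[ℂ] (ULift.{v} (Fin n → ℂ)) :=
  (TensorProduct.piScalarRight ℂ ℂ W (Fin n)).symm.trans
    (TensorProduct.congr (LinearEquiv.refl ℂ W) ULift.moduleEquiv.symm)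

theorem funEquivTensor_symm_tmul {W : Type*} [AddCommGroup W] [Module ℂ W] {n : ℕ} (w : W)
    (x : ULift.{v} (Fin n → ℂ)) :
    (funEquivTensor W n).symm (w ⊗ₜ x) = fun i => x.down i • w := by
  simp [funEquivTensor]

section SimpleModule

theorem eq_bot_or_eq_top_of_smul_mem {R : Type*} [Ring R] {W : Type*} [AddCommGroup W] [Module ℂ W]
    [Module R W] [IsSimpleModule R W] {T : Submodule ℂ W} (h : ∀ (r : R), ∀ w ∈ T, r • w ∈ T) :
    T = ⊥ ∨ T = ⊤ := by
  let T' : Submodule R W := { T with smul_mem' := fun r w hw => h r w hw }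
  refine (eq_bot_or_eq_top T').imp (fun h => ?_) fun h => ?_
  · exact (Submodule.eq_bot_iff T).2 fun w hw =>
      (Submodule.mem_bot R).1 (h ▸ (show w ∈ T' from hw))
  · exact Submodule.eq_top_iff'.2 fun w => show w ∈ T' from h ▸ Submodule.mem_top

variable {R : Type*} [Ring R] [Algebra ℂ R] {W : Type*} [AddCommGroup W] [Module ℂ W] [Module R W]
  [IsScalarTower ℂ R W] [FiniteDimensional ℂ W] [IsSimpleModule R W]

variable (R) in
theorem exists_smul_eq_of_simple (A : Module.End ℂ W) : ∃ r : R, ∀ w, A w = r • w := by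
  have := IsSimpleModule.nontrivial R W
  have htop : (Algebra.lsmul ℂ ℂ W : R →ₐ[ℂ] Module.End ℂ W).range = ⊤ :=
    subalgebra_eq_top_of_irreducible _ fun T hT =>
      eq_bot_or_eq_top_of_smul_mem (R := R) fun r w hw => hT _ ⟨r, rfl⟩ w hw
  obtain ⟨r, hr⟩ := (htop ▸ Algebra.mem_top :
    A ∈ (Algebra.lsmul ℂ ℂ W : R →ₐ[ℂ] Module.End ℂ W).range)
  exact ⟨r, fun w => hr ▸ rfl⟩

/-- Under Wⁿ = W ⊗ ℂⁿ the ring R acts as End W ⊗ 1. Each ρ(g) normalizes this action and so splits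
as a tensor product. `ULift` keeps both factors in the universe of V when W is a submodule of V. -/
theorem exists_tensor_of_linearEquiv_fun [Module R V] [IsScalarTower ℂ R V] [Nontrivial V]
    (ρ : TwistedRep α V) (M : Subgroup G) {n : ℕ} (e : V ≃ₗ[R] (Fin n → W))
    (hconj : ∀ g (r : R), ∃ r' : R, ∀ v, ρ g (r • v) = r' • ρ g v)
    (hM : ∀ m ∈ M, ∃ r : R, ∀ v, ρ m v = r • v)
    (hR : Algebra.adjoin ℂ {r : R | ∃ m ∈ M, ∀ v, ρ m v = r • v} = ⊤) :
    ∃ (β γ : Z2 G) (σ : TwistedRep β W) (τ : TwistedRep γ (ULift.{v} (Fin n → ℂ)))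
      (f : V ≃ₗ[ℂ] W ⊗[ℂ] (ULift.{v} (Fin n → ℂ))),
      (∀ g v, f (ρ g v) = σ.tensor τ g (f v)) ∧ σ.IrrOn M ∧ τ.ScalarOn M := by
  have := IsSimpleModule.nontrivial R W
  let f : V ≃ₗ[ℂ] W ⊗[ℂ] ULift.{v} (Fin n → ℂ) := (e.restrictScalars ℂ).trans (funEquivTensor W n)
  have hn : Nontrivial (ULift.{v} (Fin n → ℂ)) := by
    by_contra h
    rw [not_nontrivial_iff_subsingleton] at h
    have h1 : Subsingleton (W ⊗[ℂ] ULift.{v} (Fin n → ℂ)) := inferInstance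
    exact not_subsingleton V f.injective.subsingleton
  let L : R →ₐ[ℂ] Module.End ℂ W := Algebra.lsmul ℂ ℂ W
  have hf : ∀ (r : R) t, f.symm ((L r).rTensor _ t) = r • f.symm t := by
    intro r t
    induction t with
    | zero => simp
    | tmul w x =>
      rw [LinearMap.rTensor_tmul]
      change e.symm ((funEquivTensor W n).symm _) = r • e.symm ((funEquivTensor W n).symm _)
      rw [funEquivTensor_symm_tmul, funEquivTensor_symm_tmul, ← map_smul]
      congr 1
      ext i
      exact smul_comm _ _ _
    | add a b ha hb => simp only [map_add, ha, hb, smul_add]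
  have hf' : ∀ (r : R) v, f (r • v) = (L r).rTensor _ (f v) := by
    intro r v
    rw [← LinearEquiv.eq_symm_apply, hf, LinearEquiv.symm_apply_apply]
  obtain ⟨β, γ, σ, τ, h⟩ := exists_tensor_factors ρ f fun g => by
    obtain ⟨B, C, hBC⟩ := exists_tensor_congr_eq ((f.symm.trans (ρ g)).trans f) fun A => by
      obtain ⟨r, hr⟩ := exists_smul_eq_of_simple R A
      obtain rfl : A = L r := LinearMap.ext hr
      obtain ⟨r', hr'⟩ := hconj g r
      refine ⟨L r', fun t => ?_⟩
      simp only [LinearEquiv.trans_apply]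
      rw [hf, ← hf', hr']
    exact ⟨B, C, fun v => by simpa using hBC (f v)⟩
  -- For m in M the operator is r ⊗ 1, so uniqueness of factors makes σ(m) proportional to r and
  -- τ(m) a scalar.
  have hm : ∀ m ∈ M, ∀ r : R, (∀ v, ρ m v = r • v) →
      ∃ z : ℂˣ, (∀ w, σ m w = (z : ℂ) • r • w) ∧ ∀ x, (z : ℂ) • τ m x = x := by
    intro m hm r hr
    refine exists_scalar_of_tmul_eq (σ m) (L r) (τ m) LinearMap.id fun w x => ?_
    have h1 := h m (f.symm (w ⊗ₜ x))
    rw [hr, hf', LinearEquiv.apply_symm_apply] at h1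
    exact h1.symm
  refine ⟨β, γ, σ, τ, f, h, ⟨this, fun T hT =>
    eq_bot_or_eq_top_of_smul_mem (R := R) fun r => ?_⟩,
    fun m hmM => ?_⟩
  · have hr : r ∈ Algebra.adjoin ℂ {r : R | ∃ m ∈ M, ∀ v, ρ m v = r • v} := hR ▸ Algebra.mem_top
    induction hr using Algebra.adjoin_induction with
    | mem r hr =>
      obtain ⟨m, hmM, hr⟩ := hr
      obtain ⟨z, hz, -⟩ := hm m hmM r hr
      intro w hw
      have h1 := T.smul_mem (z⁻¹ : ℂˣ).1 (hT m hmM w hw)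
      rwa [hz, smul_smul, ← Units.val_mul, inv_mul_cancel, Units.val_one, one_smul] at h1
    | algebraMap z => intro w hw; rw [algebraMap_smul]; exact T.smul_mem z hw
    | add r s _ _ hr hs => intro w hw; rw [add_smul]; exact add_mem (hr w hw) (hs w hw)
    | mul r s _ _ hr hs => intro w hw; rw [mul_smul]; exact hr _ (hs w hw)
  · obtain ⟨r, hr⟩ := hM m hmM
    obtain ⟨z, -, hz⟩ := hm m hmM r hr
    refine ⟨z⁻¹, fun x => ?_⟩
    conv_rhs => rw [← hz x]
    rw [smul_smul, ← Units.val_mul, inv_mul_cancel, Units.val_one, one_smul]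

end SimpleModule

theorem adjoin_opAlgebra_eq_top (ρ : TwistedRep α V) (M : Subgroup G) :
    Algebra.adjoin ℂ {r : ρ.opAlgebra M | ∃ m ∈ M, ∀ v, ρ m v = r • v} = ⊤ := by
  refine Eq.trans (congrArg _ ?_) (Algebra.adjoin_adjoin_coe_preimage (R := ℂ)
    (s := {A : Module.End ℂ V | ∃ m ∈ M, A = (ρ m).toLinearMap}))
  ext r
  refine ⟨fun ⟨m, hm, h⟩ => ⟨m, hm, LinearMap.ext fun v => (h v).symm⟩, fun ⟨m, hm, h⟩ =>
    ⟨m, hm, fun v => (LinearMap.congr_fun h v).symm⟩⟩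

theorem Primitive.exists_tensor [Finite G] [FiniteDimensional ℂ V] {ρ : TwistedRep α V}
    (hp : ρ.Primitive) (hρ : ρ.IsIrreducible) (M : Subgroup G) [M.Normal] :
    ∃ (W X : Type v) (_ : AddCommGroup W) (_ : Module ℂ W) (_ : FiniteDimensional ℂ W)
      (_ : AddCommGroup X) (_ : Module ℂ X) (_ : FiniteDimensional ℂ X) (β γ : Z2 G)
      (σ : TwistedRep β W) (τ : TwistedRep γ X) (f : V ≃ₗ[ℂ] W ⊗[ℂ] X),
      (∀ g v, f (ρ g v) = σ.tensor τ g (f v)) ∧ σ.IrrOn M ∧ τ.ScalarOn M := by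
  have := hρ.1
  obtain ⟨S, n, hS, ⟨e⟩⟩ := hp.exists_linearEquiv_fun hρ M
  have : FiniteDimensional ℂ S := inferInstanceAs (FiniteDimensional ℂ (S.restrictScalars ℂ))
  obtain ⟨β, γ, σ, τ, f, h⟩ := exists_tensor_of_linearEquiv_fun (W := S) ρ M e
    (fun g r => ⟨ρ.conjEquiv M g r, fun v => by
      change ρ g (r.1 v) = (ρ g).conj r.1 (ρ g v)
      simp [LinearEquiv.conj_apply]⟩)
    (fun m hm => ⟨⟨_, ρ.mem_opAlgebra hm⟩, fun v => rfl⟩) (ρ.adjoin_opAlgebra_eq_top M)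
  exact ⟨S, ULift.{v} (Fin n → ℂ), inferInstance, inferInstance, this, inferInstance,
    inferInstance, inferInstance, β, γ, σ, τ, f, h⟩

theorem scalarOn_of_tensor {β γ : Z2 G} {W X : Type*} [AddCommGroup W] [Module ℂ W]
    [AddCommGroup X] [Module ℂ X] [Nontrivial W] [Nontrivial X] {σ : TwistedRep β W}
    {τ : TwistedRep γ X} {K : Subgroup G} (h : (σ.tensor τ).ScalarOn K) :
    σ.ScalarOn K ∧ τ.ScalarOn K := by
  have key : ∀ g ∈ K, ∃ z c : ℂˣ, (∀ w, σ g w = (z : ℂ) • w) ∧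
      ∀ x, (z : ℂ) • τ g x = (c : ℂ) • x := by
    intro g hg
    obtain ⟨c, hc⟩ := h g hg
    obtain ⟨z, hz⟩ := exists_scalar_of_tmul_eq (σ g) LinearMap.id (τ g)
      ((c : ℂ) • LinearMap.id) fun w x => by
        rw [← tensor_tmul, hc]
        simp
    exact ⟨z, c, hz⟩
  refine ⟨fun g hg => ?_, fun g hg => ?_⟩
  · obtain ⟨z, c, hz, -⟩ := key g hg
    exact ⟨z, hz⟩
  · obtain ⟨z, c, -, hz⟩ := key g hg
    refine ⟨z⁻¹ * c, fun x => ?_⟩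
    rw [Units.val_mul, mul_smul, ← hz, smul_smul, ← Units.val_mul, inv_mul_cancel, Units.val_one,
      one_smul]

theorem scalarOn_of_equiv {β : Z2 G} {U : Type*} [AddCommGroup U] [Module ℂ U]
    {ρ : TwistedRep α V} {σ : TwistedRep β U} (f : V ≃ₗ[ℂ] U) (h : ∀ g v, f (ρ g v) = σ g (f v))
    {K : Subgroup G} (hK : ρ.ScalarOn K) : σ.ScalarOn K := by
  intro g hg
  obtain ⟨z, hz⟩ := hK g hg
  refine ⟨z, fun u => ?_⟩
  obtain ⟨v, rfl⟩ := f.surjective u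
  rw [← h, hz, map_smul]

section RightFactor

variable {β γ : Z2 G} {W X : Type*} [AddCommGroup W] [Module ℂ W] [FiniteDimensional ℂ W]
  [AddCommGroup X] [Module ℂ X] [FiniteDimensional ℂ X] {ρ : TwistedRep α V}
  {σ : TwistedRep β W} {τ : TwistedRep γ X}

/-- The subspace is W ⊗ Y; its dimension carries irreducibility and primitivity from V to X. -/
theorem exists_inv_of_right_factor (f : V ≃ₗ[ℂ] W ⊗[ℂ] X)
    (h : ∀ g v, f (ρ g v) = σ.tensor τ g (f v)) {K : Subgroup G} {Y : Submodule ℂ X}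
    (hY : τ.Inv K Y) : ∃ S : Submodule ℂ V, ρ.Inv K S ∧
      Module.finrank ℂ S = Module.finrank ℂ W * Module.finrank ℂ Y := by
  refine ⟨(LinearMap.range (Y.subtype.lTensor W)).map f.symm.toLinearMap, ?_, ?_⟩
  · rintro g hg _ ⟨_, ⟨t, rfl⟩, rfl⟩
    rw [Submodule.mem_map_equiv]
    simp only [LinearEquiv.symm_symm, LinearEquiv.coe_coe]
    rw [h, LinearEquiv.apply_symm_apply]
    induction t with
    | zero => simp
    | tmul w y =>
      rw [LinearMap.lTensor_tmul, tensor_tmul]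
      exact ⟨σ g w ⊗ₜ ⟨τ g y, hY g hg y y.2⟩, rfl⟩
    | add a b ha hb => rw [map_add, map_add]; exact add_mem ha hb
  · rw [LinearEquiv.finrank_map_eq, LinearMap.finrank_range_of_inj
      (Module.Flat.lTensor_preserves_injective_linearMap _ Y.subtype_injective),
      Module.finrank_tensorProduct]

theorem IsIrreducible.right_factor [Nontrivial W] [Nontrivial X] (hρ : ρ.IsIrreducible)
    (f : V ≃ₗ[ℂ] W ⊗[ℂ] X) (h : ∀ g v, f (ρ g v) = σ.tensor τ g (f v)) : τ.IsIrreducible := by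
  rw [← irrOn_top] at hρ ⊢
  refine ⟨inferInstance, fun Y hY => ?_⟩
  obtain ⟨S, hS, hd⟩ := exists_inv_of_right_factor f h hY
  have hW : 0 < Module.finrank ℂ W := Module.finrank_pos
  have := f.symm.finiteDimensional
  refine (hρ.2 S hS).imp (fun h0 => ?_) fun h0 => ?_
  · rw [h0, finrank_bot, eq_comm, mul_eq_zero, or_iff_right hW.ne'] at hd
    exact Submodule.finrank_eq_zero.1 hd
  · rw [h0, finrank_top, f.finrank_eq, Module.finrank_tensorProduct] at hd
    exact Submodule.eq_top_of_finrank_eq (Nat.eq_of_mul_eq_mul_left hW hd).symm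

theorem Primitive.right_factor (hρ : ρ.Primitive)
    (f : V ≃ₗ[ℂ] W ⊗[ℂ] X) (h : ∀ g v, f (ρ g v) = σ.tensor τ g (f v)) : τ.Primitive := by
  intro J Y hY hd
  obtain ⟨S, hS, hd'⟩ := exists_inv_of_right_factor f h hY
  refine hρ J S hS ?_
  rw [hd', f.finrank_eq, Module.finrank_tensorProduct, hd, mul_left_comm]

end RightFactor

end TwistedRep

namespace TwistedRep

variable {G : Type*} [Group G] {π : Set ℕ}

/-! ### Factorization of primitive modules -/

/-- The module is the tensor product of a module irreducible on all Hall `π`-subgroups and one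
irreducible on all Hall `π'`-subgroups. -/
def PiFactors (π : Set ℕ) {α : Z2 G} {V : Type v} [AddCommGroup V] [Module ℂ V]
    (ρ : TwistedRep α V) : Prop :=
  ∃ (W X : Type v) (_ : AddCommGroup W) (_ : Module ℂ W) (_ : FiniteDimensional ℂ W)
    (_ : AddCommGroup X) (_ : Module ℂ X) (_ : FiniteDimensional ℂ X) (β γ : Z2 G)
    (σ : TwistedRep β W) (τ : TwistedRep γ X) (f : V ≃ₗ[ℂ] W ⊗[ℂ] X),
    (∀ g v, f (ρ g v) = σ.tensor τ g (f v)) ∧ (∀ H, IsHall π H → σ.IrrOn H) ∧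
      ∀ H, IsHall πᶜ H → τ.IrrOn H

/-- The trivial module. -/
def triv (G : Type*) [Group G] (V : Type*) [AddCommGroup V] [Module ℂ V] :
    TwistedRep (1 : Z2 G) V where
  toFun _ := LinearEquiv.refl ℂ V
  map_mul' _ _ v := (one_smul ℂ v).symm

section

variable {α : Z2 G} {V : Type v} [AddCommGroup V] [Module ℂ V] {ρ : TwistedRep α V}

/-- Scalars preserve every subspace, so V has no proper nonzero subspace; the second factor is the
trivial line. -/
theorem PiFactors.of_scalar [FiniteDimensional ℂ V] (hρ : ρ.IsIrreducible) (h : ρ.ScalarOn ⊤) : ρ.PiFactors π := by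
  have := hρ.1
  refine ⟨V, ULift.{v} ℂ, inferInstance, inferInstance, inferInstance, inferInstance,
    inferInstance, inferInstance, α, 1, ρ, triv G _, (TensorProduct.rid ℂ V).symm.trans
      (TensorProduct.congr (LinearEquiv.refl ℂ V) ULift.moduleEquiv.symm), fun g v => ?_,
    fun H _ => ⟨this, fun S _ => hρ.2 S fun g v hv => ?_⟩, fun H _ => ⟨inferInstance, fun S _ => ?_⟩⟩
  · simp [tensor_tmul, triv]
  · obtain ⟨z, hz⟩ := h g trivial
    rw [hz]
    exact S.smul_mem _ hv
  · have : IsSimpleModule ℂ (ULift.{v} ℂ) :=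
      isSimpleModule_iff_finrank_eq_one.2 (by simp)
    exact eq_bot_or_eq_top S

theorem PiFactors.compl (h : ρ.PiFactors π) : ρ.PiFactors πᶜ := by
  obtain ⟨W, X, _, _, _, _, _, _, β, γ, σ, τ, f, hf, hσ, hτ⟩ := h
  refine ⟨X, W, inferInstance, inferInstance, inferInstance, inferInstance, inferInstance,
    inferInstance, γ, β, τ, σ, f.trans (TensorProduct.comm ℂ W X), fun g v => ?_, hτ, fun H hH => ?_⟩
  · rw [LinearEquiv.trans_apply, LinearEquiv.trans_apply, hf]
    induction f v with
    | zero => simp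
    | tmul w x => simp [tensor_tmul]
    | add a b ha hb => simp only [map_add, ha, hb]
  · rw [compl_compl] at hH
    exact hσ H hH

/-- If X = A ⊗ B, then W is absorbed into the π-factor as W ⊗ A. M is scalar on A because it is
scalar on A ⊗ B, so `irrOn_tensor` applies. -/
theorem PiFactors.of_right_factor {M : Subgroup G} {W X : Type v} [AddCommGroup W] [Module ℂ W]
    [FiniteDimensional ℂ W] [AddCommGroup X] [Module ℂ X] [FiniteDimensional ℂ X] [Nontrivial X]
    {β γ : Z2 G} {σ : TwistedRep β W} {τ : TwistedRep γ X}
    (f : V ≃ₗ[ℂ] W ⊗[ℂ] X) (hf : ∀ g v, f (ρ g v) = σ.tensor τ g (f v))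
    (hσ : ∀ H, IsHall π H → σ.IrrOn (H ⊓ M)) (hτM : τ.ScalarOn M) (hτ : τ.PiFactors π) :
    ρ.PiFactors π := by
  obtain ⟨A, B, _, _, _, _, _, _, β', γ', σ', τ', f', hf', hσ', hτ'⟩ := hτ
  have hAB : Nontrivial (A ⊗[ℂ] B) := f'.symm.toEquiv.nontrivial
  have hA : Nontrivial A := by
    by_contra h
    rw [not_nontrivial_iff_subsingleton] at h
    exact not_subsingleton (A ⊗[ℂ] B) inferInstance
  have hB : Nontrivial B := by
    by_contra h
    rw [not_nontrivial_iff_subsingleton] at h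
    exact not_subsingleton (A ⊗[ℂ] B) inferInstance
  have hAM : σ'.ScalarOn M := (scalarOn_of_tensor (scalarOn_of_equiv f' hf' hτM)).1
  refine ⟨W ⊗[ℂ] A, B, inferInstance, inferInstance, inferInstance, inferInstance, inferInstance,
    inferInstance, β * β', γ', σ.tensor σ', τ',
    (f.trans (TensorProduct.congr (LinearEquiv.refl ℂ W) f')).trans
      (TensorProduct.assoc ℂ W A B).symm, fun g v => ?_, fun H hH => ?_, hτ'⟩
  · simp only [LinearEquiv.trans_apply]
    rw [hf]
    induction f v with
    | zero => simp
    | tmul w x =>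
      rw [tensor_tmul, TensorProduct.congr_tmul, TensorProduct.congr_tmul, hf']
      simp only [LinearEquiv.refl_apply]
      induction f' x with
      | zero => simp
      | tmul a b => simp [tensor_tmul]
      | add a b ha hb => simp only [map_add, TensorProduct.tmul_add, ha, hb]
    | add a b ha hb => simp only [map_add, ha, hb]
  · exact irrOn_tensor inf_le_left (hσ H hH) (hAM.mono inf_le_right) (hσ' H hH)

end

theorem Primitive.piFactors [Finite G] (hG : IsPiSeparable π G) {α : Z2 G} {V : Type v}
    [AddCommGroup V] [Module ℂ V] [FiniteDimensional ℂ V] {ρ : TwistedRep α V} (hp : ρ.Primitive)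
    (hρ : ρ.IsIrreducible) : ρ.PiFactors π := by
  obtain ⟨l, N, h0, hl, hn, hs⟩ := hG
  -- The induction ranges over all modules because the factor X, with its own cocycle, replaces V at
  -- each step.
  have key : ∀ k ≤ l, ∀ (α : Z2 G) (V : Type v) [AddCommGroup V] [Module ℂ V]
      [FiniteDimensional ℂ V] (ρ : TwistedRep α V), ρ.Primitive → ρ.IsIrreducible →
      ρ.ScalarOn (N (l - k)) → ρ.PiFactors π := by
    intro k
    induction k with
    | zero =>
      intro _ α V _ _ _ ρ hp hρ h
      rw [Nat.sub_zero, hl] at h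
      exact PiFactors.of_scalar hρ h
    | succ k ih =>
      intro hk α V _ _ _ ρ hp hρ h
      obtain ⟨i, hi⟩ : ∃ i, i = l - (k + 1) := ⟨_, rfl⟩
      have hi1 : l - k = i + 1 := by omega
      rw [← hi] at h
      have hni := hn i
      have hni1 := hn (i + 1)
      obtain ⟨hle, hfac⟩ := hs i (by omega)
      obtain ⟨W, X, _, _, _, _, _, _, β, γ, σ, τ, f, hf, hσ, hτ⟩ := hp.exists_tensor hρ (N (i + 1))
      have := hσ.1
      have := hρ.1
      have hX : Nontrivial X := by
        by_contra hX
        rw [not_nontrivial_iff_subsingleton] at hX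
        exact not_subsingleton V (f.injective.subsingleton)
      have hτ' : τ.PiFactors π := by
        refine ih (by omega) γ X τ (hp.right_factor f hf) (hρ.right_factor f hf) ?_
        rwa [hi1]
      have hσN : σ.ScalarOn (N i) := (scalarOn_of_tensor (scalarOn_of_equiv f hf h)).1
      have hirr : ∀ ω : Set ℕ, IsPiNumber ω ((N i).relIndex (N (i + 1))) → ∀ H, IsHall ω H →
          σ.IrrOn (H ⊓ N (i + 1)) := fun ω hω H hH =>
        (hσ.mono (hH.le_inf_sup hle hω)).of_sup hσN
      rcases hfac with hfac | hfac
      · exact PiFactors.of_right_factor f hf (hirr π hfac) hτ hτ'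
      · have h1 : ρ.PiFactors πᶜ := PiFactors.of_right_factor f hf (hirr πᶜ hfac) hτ hτ'.compl
        simpa using h1.compl
  refine key l le_rfl α V ρ hp hρ fun g hg => ?_
  rw [Nat.sub_self, h0, Subgroup.mem_bot] at hg
  subst hg
  exact ⟨α.1 1 1, ρ.map_one_eq⟩

/-! ### Reduction to primitive modules -/

section

variable {α : Z2 G} {V : Type v} [AddCommGroup V] [Module ℂ V] [FiniteDimensional ℂ V]
  {ρ : TwistedRep α V}

/-- Take J minimal. A nonzero submodule T of S generates V, so dim V ≤ |G:J| dim T and T = S.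
Failure of primitivity would yield a smaller subgroup, by multiplicativity of indices. -/
theorem exists_primitive_subrep [Finite G] (hρ : ρ.IsIrreducible) :
    ∃ (J : Subgroup G) (S : Submodule ℂ V) (hS : ρ.Inv J S),
      Module.finrank ℂ V = J.index * Module.finrank ℂ S ∧ (ρ.subrep S hS).IsIrreducible ∧
      (ρ.subrep S hS).Primitive := by
  have := hρ.1
  let P : Set (Subgroup G) := {J | ∃ S : Submodule ℂ V, ρ.Inv J S ∧
    Module.finrank ℂ V = J.index * Module.finrank ℂ S}
  obtain ⟨J, hJ⟩ := (Set.toFinite P).exists_minimal ⟨⊤, ⊤, fun _ _ _ _ => trivial, by simp⟩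
  obtain ⟨S, hS, hd⟩ := hJ.prop
  have hSpos : 0 < Module.finrank ℂ S := by
    refine Nat.pos_of_ne_zero fun h => ?_
    rw [h, mul_zero] at hd
    exact Module.finrank_pos.ne' hd
  refine ⟨J, S, hS, hd, ⟨Module.finrank_pos_iff.1 hSpos, fun T hT => ?_⟩, fun K T hT hd' => ?_⟩
  · refine or_iff_not_imp_left.2 fun hT0 => Submodule.eq_top_of_finrank_eq ?_
    refine le_antisymm (Submodule.finrank_le T) (Nat.le_of_mul_le_mul_left ?_
      (Nat.pos_of_ne_zero (Subgroup.index_ne_zero_of_finite (H := J))))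
    rw [← hd]
    have hT' : ρ.Inv J (T.map S.subtype) := by
      rintro g hg _ ⟨v, hv, rfl⟩
      exact ⟨_, hT ⟨g, hg⟩ v hv, rfl⟩
    rw [← Submodule.finrank_map_subtype_eq]
    refine finrank_le_index_mul hρ (ρ.subrep _ hT') (T.map S.subtype).subtype
      (fun j u => rfl) fun h0 => hT0 ?_
    have h1 := (T.map S.subtype).range_subtype
    rw [h0, LinearMap.range_zero] at h1
    exact Submodule.map_injective_of_injective S.subtype_injective
      (h1.symm.trans (Submodule.map_bot _).symm)
  · have hmem : K.map J.subtype ∈ P := by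
      refine ⟨T.map S.subtype, ?_, ?_⟩
      · rintro _ ⟨k, hk, rfl⟩ _ ⟨v, hv, rfl⟩
        exact ⟨_, hT k hk v hv, rfl⟩
      · rw [hd, hd', Subgroup.index_map_subtype, Submodule.finrank_map_subtype_eq,
          mul_assoc, mul_left_comm]
    have h := hJ.le_of_le hmem (Subgroup.map_subtype_le K)
    refine Subgroup.eq_top_iff' _ |>.2 fun k => ?_
    obtain ⟨k', hk', h⟩ := h k.2
    rwa [← Subtype.ext h]

end

end TwistedRep

open TwistedRep

/-! ### Existence and properties of π-decompositions -/

section Decomposition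

variable {G : Type*} [Group G] {π : Set ℕ} {α : Z2 G}

theorem TwistedRep.SameProj.irrOn {β γ : Z2 G} {V : Type*} [AddCommGroup V] [Module ℂ V]
    {ρ : TwistedRep β V} {σ : TwistedRep γ V} (h : SameProj ρ σ) {K : Subgroup G}
    (hσ : σ.IrrOn K) : ρ.IrrOn K := by
  refine ⟨hσ.1, fun S hS => hσ.2 S fun g hg v hv => ?_⟩
  obtain ⟨z, hz⟩ := h g
  have h1 := S.smul_mem (z⁻¹ : ℂˣ).1 (hS g hg v hv)
  rwa [hz, smul_smul, ← Units.val_mul, inv_mul_cancel, Units.val_one, one_smul] at h1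

theorem TwistedRep.IsIrreducible.exists_isPiDecomposition [Finite G] (hG : IsPiSeparable π G)
    {V : Type v} [AddCommGroup V] [Module ℂ V] [FiniteDimensional ℂ V] {ρ : TwistedRep α V}
    (hρ : ρ.IsIrreducible) :
    ∃ (cp cq : H2 G) (J : Subgroup G) (β γ : Z2 J)
      (Vp : Type v) (_ : AddCommGroup Vp) (_ : Module ℂ Vp) (_ : FiniteDimensional ℂ Vp)
      (Vq : Type v) (_ : AddCommGroup Vq) (_ : Module ℂ Vq) (_ : FiniteDimensional ℂ Vq)
      (σ : TwistedRep β Vp) (τ : TwistedRep γ Vq), IsPiDecomposition π ρ cp cq J σ τ := by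
  obtain ⟨cp, cq, hfac⟩ := exists_isPiFactorization π (coclass α)
  obtain ⟨J, S, hS, hd, hirr, hprim⟩ := exists_primitive_subrep hρ
  have hJ := hG.subgroup J
  obtain ⟨W, X, _, _, _, _, _, _, β, γ, σ, τ, f, hf, hσ, hτ⟩ := hprim.piFactors hJ hirr
  obtain ⟨H, hH⟩ := hJ.exists_hall
  obtain ⟨H', hH'⟩ := hJ.compl.exists_hall
  have := hirr.1
  have := (hσ H hH).1
  have := (hτ H' hH').1
  have hcoc : resZ2 J α = β * γ := cocycle_eq_of_equiv f hf
  have hβ := σ.isPiNumber_orderOf ((hσ H hH).isPiNumber_finrank hH.1)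
  have hγ := τ.isPiNumber_orderOf ((hτ H' hH').isPiNumber_finrank hH'.1)
  -- The degrees of the factors bound the orders of their coclasses, so [β][γ] is the
  -- π-factorization of the restriction of c.
  obtain ⟨hβ', hγ'⟩ := IsPiFactorization.unique
    (show IsPiFactorization π (resH2 J (coclass α)) (coclass β) (coclass γ) from
      ⟨by rw [resH2_coclass, hcoc, coclass_mul], hβ, hγ⟩) (hfac.res J)
  let θ : TwistedRep (resZ2 J α) (W ⊗[ℂ] X) :=
    { toFun := σ.tensor τ
      map_mul' := by rw [hcoc]; exact (σ.tensor τ).map_mul' }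
  refine ⟨cp, cq, J, β, γ, W, inferInstance, inferInstance, inferInstance, X, inferInstance,
    inferInstance, inferInstance, σ, τ, hfac, hβ', hγ', irrOn_top.1 ((hσ H hH).mono le_top),
    irrOn_top.1 ((hτ H' hH').mono le_top), ⟨θ, fun g => ⟨1, fun v => (one_smul ℂ _).symm⟩, ?_⟩,
    fun H hH => isIrreducible_res.2 (hσ H hH), fun H hH => isIrreducible_res.2 (hτ H hH)⟩
  refine isomorphic_ind hρ θ (S.subtype ∘ₗ f.symm.toLinearMap) (fun j t => ?_) (fun h0 => ?_) ?_
  · obtain ⟨s, rfl⟩ := f.surjective t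
    change ((f.symm (σ.tensor τ j (f s)) : S) : V) = ρ j ((f.symm (f s) : S) : V)
    rw [← hf, LinearEquiv.symm_apply_apply, LinearEquiv.symm_apply_apply]
    rfl
  · obtain ⟨s, hs⟩ := exists_ne (0 : S)
    have h1 := LinearMap.congr_fun h0 (f s)
    simp only [LinearMap.comp_apply, LinearEquiv.coe_coe, LinearEquiv.symm_apply_apply] at h1
    exact hs (Subtype.ext h1)
  · rw [hd, f.finrank_eq]

section Properties

variable {V : Type*} [AddCommGroup V] [Module ℂ V] {ρ : TwistedRep α V} {cp cq : H2 G}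
  {J : Subgroup G} {β γ : Z2 J} {Vp : Type*} [AddCommGroup Vp] [Module ℂ Vp]
  {Vq : Type*} [AddCommGroup Vq] [Module ℂ Vq] {σ : TwistedRep β Vp} {τ : TwistedRep γ Vq}

theorem IsPiDecomposition.finrank_eq [Finite G] [FiniteDimensional ℂ Vp]
    [FiniteDimensional ℂ Vq]
    (h : IsPiDecomposition π ρ cp cq J σ τ) :
    Module.finrank ℂ V = J.index * (Module.finrank ℂ Vp * Module.finrank ℂ Vq) := by
  rw [h.induced.finrank_eq, Module.finrank_tensorProduct]

theorem IsPiDecomposition.isPiNumber_left [Finite G] [FiniteDimensional ℂ Vp]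
    (h : IsPiDecomposition π ρ cp cq J σ τ)
    (hG : IsPiSeparable π G) : IsPiNumber π (Module.finrank ℂ Vp) := by
  obtain ⟨H, hH⟩ := (hG.subgroup J).exists_hall
  exact (isIrreducible_res.1 (h.hall_left H hH)).isPiNumber_finrank hH.1

theorem IsPiDecomposition.isPiNumber_right [Finite G] [FiniteDimensional ℂ Vq]
    (h : IsPiDecomposition π ρ cp cq J σ τ)
    (hG : IsPiSeparable π G) : IsPiNumber πᶜ (Module.finrank ℂ Vq) := by
  obtain ⟨H, hH⟩ := (hG.subgroup J).compl.exists_hall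
  exact (isIrreducible_res.1 (h.hall_right H hH)).isPiNumber_finrank hH.1

theorem IsPiDecomposition.piPart_finrank [Finite G] [FiniteDimensional ℂ Vp]
    [FiniteDimensional ℂ Vq]
    (h : IsPiDecomposition π ρ cp cq J σ τ)
    (hG : IsPiSeparable π G) :
    piPart π (Module.finrank ℂ V) = piPart π J.index * Module.finrank ℂ Vp := by
  have hp := h.isPiNumber_left hG
  have hq := h.isPiNumber_right hG
  rw [h.finrank_eq, piPart_mul π Subgroup.index_ne_zero_of_finite (mul_ne_zero hp.1 hq.1),
    piPart_mul π hp.1 hq.1, hp.piPart_eq, (piPart_eq_one_iff hq.1).2 hq, mul_one]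

theorem IsPiDecomposition.piPart_compl_finrank [Finite G] [FiniteDimensional ℂ Vp]
    [FiniteDimensional ℂ Vq]
    (h : IsPiDecomposition π ρ cp cq J σ τ)
    (hG : IsPiSeparable π G) :
    piPart πᶜ (Module.finrank ℂ V) = piPart πᶜ J.index * Module.finrank ℂ Vq := by
  have hp := h.isPiNumber_left hG
  have hq := h.isPiNumber_right hG
  rw [h.finrank_eq, piPart_mul πᶜ Subgroup.index_ne_zero_of_finite (mul_ne_zero hp.1 hq.1),
    piPart_mul πᶜ hp.1 hq.1, hq.piPart_eq, (piPart_eq_one_iff hp.1).2 (by rwa [compl_compl]),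
    one_mul]

theorem IsPiDecomposition.isPiNumber_compl_iff [Finite G] [FiniteDimensional ℂ Vp]
    [FiniteDimensional ℂ Vq]
    (h : IsPiDecomposition π ρ cp cq J σ τ)
    (hG : IsPiSeparable π G) : IsPiNumber πᶜ (Module.finrank ℂ V) ↔
      IsPiNumber πᶜ J.index ∧ Module.finrank ℂ Vp = 1 := by
  have hp := h.isPiNumber_left hG
  have hq := h.isPiNumber_right hG
  have hV : Module.finrank ℂ V ≠ 0 := by
    rw [h.finrank_eq]
    exact mul_ne_zero Subgroup.index_ne_zero_of_finite (mul_ne_zero hp.1 hq.1)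
  rw [← piPart_eq_one_iff hV, h.piPart_finrank hG, mul_eq_one,
    piPart_eq_one_iff Subgroup.index_ne_zero_of_finite]

/-- The order of the restricted coclass divides |H|, a π-number, and the order of c_π', a π'-number.
-/
theorem IsPiDecomposition.coclass_res_right [Finite G]
    (h : IsPiDecomposition π ρ cp cq J σ τ)
    {H : Subgroup J} (hH : IsHall π H) : coclass (resZ2 H γ) = 1 := by
  refine eq_one_of_isPiNumber hH.1 ?_
  rw [← resH2_coclass, h.coclass_right]
  exact h.factorization.2.2.of_dvd ((orderOf_resH2_dvd _ _).trans (orderOf_resH2_dvd _ _))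

theorem IsPiDecomposition.coclass_res_left [Finite G]
    (h : IsPiDecomposition π ρ cp cq J σ τ)
    {H : Subgroup J} (hH : IsHall πᶜ H) : coclass (resZ2 H β) = 1 := by
  refine eq_one_of_isPiNumber hH.1 ?_
  rw [← resH2_coclass, h.coclass_left, compl_compl]
  exact h.factorization.2.1.of_dvd ((orderOf_resH2_dvd _ _).trans (orderOf_resH2_dvd _ _))

theorem IsPiDecomposition.left_eq_one (h : IsPiDecomposition π ρ cp cq J σ τ)
    (hV : IsPiNumber πᶜ (Module.finrank ℂ V)) : cp = 1 :=
  IsPiFactorization.eq_one_left h.factorization (ρ.isPiNumber_orderOf hV)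

theorem TwistedRep.irrOn_of_finrank_eq_one (σ : TwistedRep β Vp) (h : Module.finrank ℂ Vp = 1)
    (K : Subgroup J) : σ.IrrOn K := by
  have : IsSimpleModule ℂ Vp := isSimpleModule_iff_finrank_eq_one.2 h
  exact ⟨IsSimpleModule.nontrivial ℂ Vp, fun S _ => eq_bot_or_eq_top S⟩

theorem TwistedRep.irrOn_tensor_of_finrank_eq_one [FiniteDimensional ℂ Vp]
    (σ : TwistedRep β Vp)
    (h : Module.finrank ℂ Vp = 1) {K : Subgroup J} (hτ : τ.IrrOn K) : (σ.tensor τ).IrrOn K := by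
  -- A line is irreducible even on the trivial subgroup, where τ is automatically scalar.
  refine irrOn_tensor bot_le (σ.irrOn_of_finrank_eq_one h ⊥) (fun g hg => ?_) hτ
  rw [Subgroup.mem_bot] at hg
  subst hg
  exact ⟨γ.1 1 1, τ.map_one_eq⟩

theorem TwistedRep.projEquivalent_tensor_of_finrank_eq_one [FiniteDimensional ℂ Vp]
    (σ : TwistedRep β Vp)
    (τ : TwistedRep γ Vq) (h : Module.finrank ℂ Vp = 1) (K : Subgroup J) :
    ((σ.tensor τ).res K).ProjEquivalent (τ.res K) := by
  let e : Vp ≃ₗ[ℂ] ℂ := LinearEquiv.ofFinrankEq _ _ (by rw [h, Module.finrank_self])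
  let f : Vp ⊗[ℂ] Vq ≃ₗ[ℂ] Vq :=
    (TensorProduct.congr e (LinearEquiv.refl ℂ Vq)).trans (TensorProduct.lid ℂ Vq)
  refine ⟨f, fun g => ?_⟩
  -- This is the scalar by which g acts on the line; it is the projective discrepancy between the
  -- two modules.
  have h0 : e (σ g (e.symm 1)) ≠ 0 := by simp
  refine ⟨Units.mk0 _ h0, fun t => ?_⟩
  change f (σ.tensor τ g t) = _ • τ g (f t)
  induction t with
  | zero => simp
  | tmul x y =>
    obtain ⟨z, rfl⟩ := e.symm.surjective x
    have h1 : e.symm z = z • e.symm 1 := by rw [← map_smul, smul_eq_mul, mul_one]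
    rw [tensor_tmul]
    simp only [f, LinearEquiv.trans_apply, TensorProduct.congr_tmul, TensorProduct.lid_tmul,
      LinearEquiv.refl_apply, LinearEquiv.apply_symm_apply, map_smul, Units.val_mk0]
    rw [h1, map_smul, map_smul, smul_smul, smul_eq_mul, mul_comm]
  | add a b ha hb => rw [map_add, map_add, ha, hb, map_add, map_add, smul_add]

end Properties

end Decomposition

end SchurProj

theorem mainTheorem4 {G : Type u} [Group G] [Finite G] (π : Set ℕ) (hG : IsPiSeparable π G)
    (α : Z2 G) {V : Type v} [AddCommGroup V] [Module ℂ V] [FiniteDimensional ℂ V]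
    (ρ : TwistedRep α V) (hρ : ρ.IsIrreducible) :
    -- `V` has a `π`-decomposition
    (∃ (cp cq : H2 G) (J : Subgroup G) (β γ : Z2 J)
      (Vp : Type v) (_ : AddCommGroup Vp) (_ : Module ℂ Vp) (_ : FiniteDimensional ℂ Vp)
      (Vq : Type v) (_ : AddCommGroup Vq) (_ : Module ℂ Vq) (_ : FiniteDimensional ℂ Vq)
      (σ : TwistedRep β Vp) (τ : TwistedRep γ Vq),
      IsPiDecomposition π ρ cp cq J σ τ) ∧
    -- every `π`-decomposition of `V` has the stated properties
    (∀ (cp cq : H2 G) (J : Subgroup G) (β γ : Z2 J)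
      (Vp : Type w) [AddCommGroup Vp] [Module ℂ Vp] [FiniteDimensional ℂ Vp]
      (Vq : Type w') [AddCommGroup Vq] [Module ℂ Vq] [FiniteDimensional ℂ Vq]
      (σ : TwistedRep β Vp) (τ : TwistedRep γ Vq),
      IsPiDecomposition π ρ cp cq J σ τ →
      piPart π (Module.finrank ℂ V) = piPart π J.index * Module.finrank ℂ Vp ∧
      piPart πᶜ (Module.finrank ℂ V) = piPart πᶜ J.index * Module.finrank ℂ Vq ∧
      ∀ H H' : Subgroup J, IsHall π H → IsHall πᶜ H' →
        coclass (resZ2 H γ) = 1 ∧ coclass (resZ2 H' β) = 1 ∧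
        (IsPiNumber πᶜ (Module.finrank ℂ V) ↔
          IsHall π (H.map J.subtype) ∧ cp = 1 ∧ Module.finrank ℂ Vp = 1 ∧
          ((σ.tensor τ).res H').ProjEquivalent (τ.res H') ∧
          ((σ.tensor τ).res H').IsIrreducible)) ∧
    -- the resulting characterization of the modules of `π'`-degree
    (IsPiNumber πᶜ (Module.finrank ℂ V) ↔
      ∃ (J : Subgroup G) (U : Type v) (_ : AddCommGroup U) (_ : Module ℂ U)
        (_ : FiniteDimensional ℂ U) (σ : TwistedRep (resZ2 J α) U),
        ρ.Isomorphic σ.ind ∧ (∃ H : Subgroup G, IsHall π H ∧ H ≤ J) ∧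
        ∀ H' : Subgroup J, IsHall πᶜ H' → (σ.res H').IsIrreducible) := by
  refine ⟨hρ.exists_isPiDecomposition hG, ?_, fun hV => ?_, ?_⟩
  · intro cp cq J β γ Vp _ _ _ Vq _ _ _ σ τ h
    refine ⟨h.piPart_finrank hG, h.piPart_compl_finrank hG, fun H H' hH hH' =>
      ⟨h.coclass_res_right hH, h.coclass_res_left hH', fun hV => ?_, fun hV => ?_⟩⟩
    · obtain ⟨hJ, hd⟩ := (h.isPiNumber_compl_iff hG).1 hV
      exact ⟨hH.map_subtype hJ, h.left_eq_one hV, hd,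
        TwistedRep.projEquivalent_tensor_of_finrank_eq_one σ τ hd H',
        TwistedRep.isIrreducible_res.2 (TwistedRep.irrOn_tensor_of_finrank_eq_one σ hd
          (TwistedRep.isIrreducible_res.1 (h.hall_right H' hH')))⟩
    · refine (h.isPiNumber_compl_iff hG).2 ⟨?_, hV.2.2.1⟩
      -- |G:J| divides |G:H|, which is a π'-number.
      exact hV.1.2.of_dvd (by rw [Subgroup.index_map_subtype]; exact dvd_mul_left _ _)
  · obtain ⟨cp, cq, J, β, γ, Vp, _, _, _, Vq, _, _, _, σ, τ, h⟩ := hρ.exists_isPiDecomposition hG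
    obtain ⟨hJ, hd⟩ := (h.isPiNumber_compl_iff hG).1 hV
    obtain ⟨H, hH⟩ := (hG.subgroup J).exists_hall
    obtain ⟨θ, hθ, hiso⟩ := h.induced
    exact ⟨J, TensorProduct ℂ Vp Vq, inferInstance, inferInstance, inferInstance, θ, hiso,
      ⟨H.map J.subtype, hH.map_subtype hJ, Subgroup.map_subtype_le H⟩, fun H' hH' =>
        TwistedRep.isIrreducible_res.2 (hθ.irrOn (TwistedRep.irrOn_tensor_of_finrank_eq_one σ hd
          (TwistedRep.isIrreducible_res.1 (h.hall_right H' hH'))))⟩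
  · rintro ⟨J, U, _, _, _, σ, ⟨f, -⟩, ⟨H, hH, hHJ⟩, hirr⟩
    obtain ⟨H', hH'⟩ := (hG.subgroup J).compl.exists_hall
    rw [f.finrank_eq, TwistedRep.finrank_indSpace]
    -- dim V = |G:J| dim U, where |G:J| divides |G:H| and dim U divides |H'|.
    exact (hH.2.of_dvd (Subgroup.index_dvd_of_le hHJ)).mul
      ((TwistedRep.isIrreducible_res.1 (hirr H' hH')).isPiNumber_finrank hH'.1)
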